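/- **Setting.** All manifolds are smooth, finite-dimensional, Hausdorff and second countable. Let $\overline G$ be a Lie group acting smoothly, transitively and by isometries on a Riemannian manifold $(\overline M,\overline g)$, with $\overline M=\overline G/\overline H$ as a manifold, $\overline H$ being the isotropy group of $o\in\overline M$. Write $L_p$ for the action of $p\in\overline G$, $X^*_q=\frac{d}{dt}\big|_{t=0}\exp(tX)\cdot q$ for the fundamental vector field of $X\in\overline{\mathfrak g}$, and $\overline\nabla^{g}$ for the Levi-Civita connection of $\overline g$. Let $\overline{\mathfrak g}=\overline{\mathfrak h}\oplus\overline{\mathfrak m}$ be a reductive decomposition ($\overline{\mathfrak h}$ is the Lie algebra of $\overline H$ and $\overline{\mathfrak m}$ is an $\mathrm{Ad}(\overline H)$-invariant subspace), and let $\tilde\nabla$ be the associated canonical connection, i.e. the $\overline G$-invariant linear connection on $\overline M$ with $$(\tilde\nabla_{X^*}B^*)_o=-[X,B]^*_o\qquad\text{for all }X\in\overline{\mathfrak m},\ B\in\overline{\mathfrak g}.$$ Let $M\subset\overline M$ be an embedded submanifold (for instance a closed orbit of a Lie subgroup of $\overline G$), let $E=T\overline M|_M$, and let $D$ be a (smooth)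 linear connection on the vector bundle $E\to M$ such that * $D$ is a $\overline G$-connection: for every piecewise smooth curve $c:[a,b]\to M$ there is $p\in\overline G$ such that the $D$-parallel transport $\tau_c:E_{c(a)}\to E_{c(b)}$ is $\tau_c(v)=(L_p)_*v$ for all $v\in E_{c(a)}$; * $TM\subset E$ is a $D$-parallel subbundle, so that $D$ also induces a connection on $TM$. A tensor field $A:TM\to\mathrm{End}(E)$ is called $D$-parallel if $D_U(A_Y\sigma)=A_{D_UY}\sigma+A_Y(D_U\sigma)$ for all vector fields $U,Y$ on $M$ and all sections $\sigma$ of $E$. **Lemma 4.1.** Regard $\tilde\nabla$ and $\overline\nabla^{g}$ as connections on $E\to M$ by restriction. Then the tensor $\Gamma=\tilde\nabla-D:TM\to\mathrm{End}(E)$ is $D$-parallel if and only if the tensor $S=\overline\nabla^{g}-D:TM\to\mathrm{End}(E)$ is $D$-parallel. -/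

import Mathlib

open Bundle Manifold Set VectorField
open scoped ContDiff Topology

noncomputable section

set_option linter.unusedSectionVars false

namespace HomStruct

/-! ### Fibres of a pullback bundle -/

section PullbackInstances

variable {B B' : Type*} (E : B → Type*) (f : B' → B)

instance instAddCommGroupPullback [∀ x, AddCommGroup (E x)] (x : B') :
    AddCommGroup ((f *ᵖ E) x) :=
  inferInstanceAs <| AddCommGroup (E (f x))

instance instIsTopologicalAddGroupPullback [∀ x, AddCommGroup (E x)]
    [∀ x, TopologicalSpace (E x)] [∀ x, IsTopologicalAddGroup (E x)] (x : B') :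
    IsTopologicalAddGroup ((f *ᵖ E) x) :=
  inferInstanceAs <| IsTopologicalAddGroup (E (f x))

instance instContinuousSMulPullback [∀ x, AddCommGroup (E x)] [∀ x, Module ℝ (E x)]
    [∀ x, TopologicalSpace (E x)] [∀ x, ContinuousSMul ℝ (E x)] (x : B') :
    ContinuousSMul ℝ ((f *ᵖ E) x) :=
  inferInstanceAs <| ContinuousSMul ℝ (E (f x))

end PullbackInstances

/-! ### Covariant derivatives of sections along a map, and the pullback of a connection -/

section Along

variable {EB : Type*} [NormedAddCommGroup EB] [NormedSpace ℝ EB]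
  {B : Type*} [TopologicalSpace B] [ChartedSpace EB B]
  (F : Type*) [NormedAddCommGroup F] [NormedSpace ℝ F]
  {V : B → Type*} [TopologicalSpace (TotalSpace F V)]
  [∀ x, AddCommGroup (V x)] [∀ x, Module ℝ (V x)] [∀ x, TopologicalSpace (V x)]
  [∀ x, IsTopologicalAddGroup (V x)] [∀ x, ContinuousSMul ℝ (V x)]
  [FiberBundle F V] [VectorBundle ℝ F V]
  {EN : Type*} [NormedAddCommGroup EN] [NormedSpace ℝ EN]
  {N : Type*} [TopologicalSpace N] [ChartedSpace EN N]

/-- The local section of `V` through `v ∈ V x` whose coordinates in a trivialization around `x`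
are constant. -/
def constSection {x : B} (v : V x) (y : B) : V y :=
  (trivializationAt F V x).symmL ℝ y ((trivializationAt F V x).continuousLinearMapAt ℝ x v)

/-- The covariant derivative at `x`, within `s`, of a section `σ` of `V` along a map `f : N → B`,
as a linear map in the direction.  In a local frame `(e_i)` of `V` around `f x` in which
`σ = ∑ σ^i (e_i ∘ f)` it is `u ↦ ∑ dσ^i(u) e_i(f x) + ∑ σ^i(x) (∇_{df(u)} e_i)(f x)`; here the
frame is that of a trivialization, the first term is the derivative of the coordinate vector of
`σ`, and `∑ σ^i(x) e_i` is the section `constSection F (σ x)`. -/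
def covAlong (nabla : CovariantDerivative 𝓘(ℝ, EB) F V) (f : N → B) (σ : Π x : N, V (f x))
    (s : Set N) (x : N) : TangentSpace 𝓘(ℝ, EN) x →L[ℝ] V (f x) :=
  ((trivializationAt F V (f x)).symmL ℝ (f x)) ∘L
      mvfderivWithin 𝓘(ℝ, EN)
        (fun y ↦ (trivializationAt F V (f x)).continuousLinearMapAt ℝ (f y) (σ y)) s x
    + (nabla (constSection F (σ x)) (f x)) ∘L mfderivWithin 𝓘(ℝ, EN) 𝓘(ℝ, EB) f s x

variable {F}

theorem constSection_add {x : B} (v w : V x) :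
    constSection F (v + w) = constSection F v + constSection F w := by
  ext y; simp [constSection]

theorem constSection_smul {x : B} (a : ℝ) (v : V x) :
    constSection F (a • v) = a • constSection F v := by
  ext y; simp [constSection]

theorem mdifferentiableAt_constSection {x : B} (v : V x) :
    MDiffAt (T% (constSection F v)) x := by
  rw [mdifferentiableAt_section]
  refine (mdifferentiableAt_const
    (c := (trivializationAt F V x).continuousLinearMapAt ℝ x v)).congr_of_eventuallyEq ?_
  filter_upwards [(trivializationAt F V x).open_baseSet.mem_nhds
    (FiberBundle.mem_baseSet_trivializationAt' x)] with y hy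
  simp [constSection, hy, -Trivialization.continuousLinearMapAt_apply]

theorem covAlong_add (nabla : CovariantDerivative 𝓘(ℝ, EB) F V) (f : N → B)
    {σ σ' : Π x : N, V (f x)} {x : N}
    (hσ : MDiffAt (fun y ↦ (trivializationAt F V (f x)).continuousLinearMapAt ℝ (f y) (σ y)) x)
    (hσ' : MDiffAt (fun y ↦ (trivializationAt F V (f x)).continuousLinearMapAt ℝ (f y) (σ' y)) x) :
    covAlong (EN := EN) F nabla f (fun y ↦ σ y + σ' y) univ x =
      covAlong F nabla f σ univ x + covAlong F nabla f σ' univ x := by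
  simp only [covAlong, mvfderivWithin_univ, map_add]
  rw [constSection_add, nabla.isCovariantDerivativeOnUniv.add
    (mdifferentiableAt_constSection _) (mdifferentiableAt_constSection _),
    mvfderiv_fun_add hσ hσ']
  ext u
  simp only [_root_.add_apply, ContinuousLinearMap.comp_apply, map_add]
  abel

theorem covAlong_smul (nabla : CovariantDerivative 𝓘(ℝ, EB) F V) (f : N → B)
    {g : N → ℝ} {σ : Π x : N, V (f x)} {x : N} (hg : MDiffAt g x)
    (hσ : MDiffAt (fun y ↦ (trivializationAt F V (f x)).continuousLinearMapAt ℝ (f y) (σ y)) x) :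
    covAlong (EN := EN) F nabla f (fun y ↦ g y • σ y) univ x =
      g x • covAlong F nabla f σ univ x + (mvfderiv 𝓘(ℝ, EN) g x).smulRight (σ x) := by
  have h : (trivializationAt F V (f x)).symmL ℝ (f x)
      ((trivializationAt F V (f x)).continuousLinearMapAt ℝ (f x) (σ x)) = σ x :=
    (trivializationAt F V (f x)).symmL_continuousLinearMapAt
      (FiberBundle.mem_baseSet_trivializationAt' (f x)) _
  simp only [covAlong, mvfderivWithin_univ, map_smul]
  rw [constSection_smul, nabla.isCovariantDerivativeOnUniv.smul_const _
    (mdifferentiableAt_constSection _), mvfderiv_fun_smul hg hσ]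
  ext u
  simp only [_root_.add_apply, ContinuousLinearMap.comp_apply,
    _root_.smul_apply, ContinuousLinearMap.smulRight_apply, map_add, map_smul,
    h, smul_add]
  abel

theorem mdifferentiableAt_coord (f : C^∞⟮𝓘(ℝ, EN), N; 𝓘(ℝ, EB), B⟯)
    {σ : Π x : N, ((f : N → B) *ᵖ V) x} {x : N}
    (hσ : MDifferentiableAt 𝓘(ℝ, EN) (𝓘(ℝ, EN).prod 𝓘(ℝ, F))
      (fun y ↦ TotalSpace.mk' F (E := (f : N → B) *ᵖ V) y (σ y)) x) :
    MDiffAt (fun y ↦ (trivializationAt F V (f x)).continuousLinearMapAt ℝ (f y)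
      (show V (f y) from σ y)) x := by
  rw [mdifferentiableAt_section] at hσ
  refine hσ.congr_of_eventuallyEq ?_
  filter_upwards [f.contMDiff.continuous.continuousAt.preimage_mem_nhds
    ((trivializationAt F V (f x)).open_baseSet.mem_nhds
    (FiberBundle.mem_baseSet_trivializationAt' (f x)))] with y hy
  exact congrFun ((trivializationAt F V (f x)).coe_linearMapAt_of_mem (R := ℝ) hy) _

/-- The pullback of a connection on `V → B` by a smooth map `f : N → B`, a connection on the
pullback bundle `f^* V → N`. -/
def pullbackConnection (nabla : CovariantDerivative 𝓘(ℝ, EB) F V)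
    (f : C^∞⟮𝓘(ℝ, EN), N; 𝓘(ℝ, EB), B⟯) :
    CovariantDerivative 𝓘(ℝ, EN) F ((f : N → B) *ᵖ V) where
  toFun σ x := covAlong F nabla f σ univ x
  isCovariantDerivativeOnUniv :=
    { add := fun hσ hσ' _ ↦
        covAlong_add nabla f (mdifferentiableAt_coord f hσ) (mdifferentiableAt_coord f hσ')
      leibniz := fun hσ hg _ ↦
        covAlong_smul nabla f hg (mdifferentiableAt_coord f hσ) }

end Along

/-! ### Reductive homogeneous Riemannian manifolds -/

section Homogeneous

variable {EG : Type*} [NormedAddCommGroup EG] [NormedSpace ℝ EG]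
  {G : Type*} [TopologicalSpace G] [ChartedSpace EG G] [Group G]
  {EB : Type*} [NormedAddCommGroup EB] [NormedSpace ℝ EB]
  {B : Type*} [TopologicalSpace B] [ChartedSpace EB B] [MulAction G B]

/-- The fundamental vector field `X^*` of `X` in the Lie algebra of `G`,
`X^*_p = d/dt|_{t=0} exp(tX) • p`, that is, the value at `X` of the differential at `1` of the
orbit map `g ↦ g • p`. -/
def fundamentalField (X : GroupLieAlgebra 𝓘(ℝ, EG) G) (p : B) : TangentSpace 𝓘(ℝ, EB) p :=
  mfderiv 𝓘(ℝ, EG) 𝓘(ℝ, EB) (fun g : G ↦ g • p) 1 X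

variable (EB) in
/-- The Lie algebra of the isotropy group of `o`: the kernel of `X ↦ X^*_o`. -/
def isotropyAlgebra (o : B) : Submodule ℝ (GroupLieAlgebra 𝓘(ℝ, EG) G) :=
  LinearMap.ker (mfderiv 𝓘(ℝ, EG) 𝓘(ℝ, EB) (fun g : G ↦ g • o) 1).toLinearMap

/-- The adjoint representation: the differential at `1` of the conjugation by `h`. -/
def Ad (h : G) (X : GroupLieAlgebra 𝓘(ℝ, EG) G) : GroupLieAlgebra 𝓘(ℝ, EG) G :=
  mfderiv 𝓘(ℝ, EG) 𝓘(ℝ, EG) (fun k : G ↦ h * k * h⁻¹) 1 X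

variable [IsManifold 𝓘(ℝ, EB) ∞ B]

variable (EG G) in
/-- `(B, metric)` is a homogeneous Riemannian manifold of `G`: the group acts transitively, by
isometries, and the orbit maps `G → B` are submersions at the identity, which says that `B` is
`G ⧸ H` as a manifold, `H` being the isotropy group of a point. -/
structure IsHomogeneousRiemannian (metric : ContMDiffRiemannianMetric 𝓘(ℝ, EB) ∞ EB
    (TangentSpace 𝓘(ℝ, EB) : B → Type _)) : Prop where
  transitive : ∀ p q : B, ∃ g : G, g • p = q
  submersion : ∀ p : B, Function.Surjective (fun X : GroupLieAlgebra 𝓘(ℝ, EG) G ↦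
    (fundamentalField X p : TangentSpace 𝓘(ℝ, EB) p))
  isometry : ∀ (g : G) (p : B) (v w : TangentSpace 𝓘(ℝ, EB) p),
    metric.inner (g • p) (mfderiv 𝓘(ℝ, EB) 𝓘(ℝ, EB) (fun q : B ↦ g • q) p v)
      (mfderiv 𝓘(ℝ, EB) 𝓘(ℝ, EB) (fun q : B ↦ g • q) p w) = metric.inner p v w

variable (EB) in
/-- `𝔤 = 𝔥 ⊕ 𝔪` is a reductive decomposition, `𝔥` being the Lie algebra of the isotropy group `H`
of `o`: the subspace `𝔪` is a complement of `𝔥` and is `Ad(H)`-invariant. -/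
structure IsReductiveDecomposition (o : B) (𝔪 : Submodule ℝ (GroupLieAlgebra 𝓘(ℝ, EG) G)) :
    Prop where
  isCompl : IsCompl (isotropyAlgebra EB o) 𝔪
  ad_mem : ∀ h : G, h • o = o → ∀ X ∈ 𝔪, Ad h X ∈ 𝔪

/-- The canonical connection of the reductive decomposition `𝔤 = 𝔥 ⊕ 𝔪` at `o`: the smooth
`G`-invariant linear connection on `B` with `(∇_{X^*} Y^*)_o = -[X, Y]^*_o` for `X ∈ 𝔪` and
`Y ∈ 𝔤`.  Invariance is `(L_g)_* (∇_u (L_g^* σ)) = ∇_{(L_g)_* u} σ`. -/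
structure IsCanonicalConnection (o : B) (𝔪 : Submodule ℝ (GroupLieAlgebra 𝓘(ℝ, EG) G))
    (nabla : CovariantDerivative 𝓘(ℝ, EB) EB (TangentSpace 𝓘(ℝ, EB) : B → Type _)) : Prop where
  smooth : nabla.ContMDiffCovariantDerivative ∞
  invariant : ∀ (g : G) (σ : Π p : B, TangentSpace 𝓘(ℝ, EB) p), CMDiff ∞ (T% σ) →
    ∀ (p : B) (u : TangentSpace 𝓘(ℝ, EB) p),
      mfderiv 𝓘(ℝ, EB) 𝓘(ℝ, EB) (fun q : B ↦ g • q) p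
        (nabla (mpullback 𝓘(ℝ, EB) 𝓘(ℝ, EB) (fun q : B ↦ g • q) σ) p u) =
      nabla σ (g • p) (mfderiv 𝓘(ℝ, EB) 𝓘(ℝ, EB) (fun q : B ↦ g • q) p u)
  apply_fundamentalField : ∀ X ∈ 𝔪, ∀ Y : GroupLieAlgebra 𝓘(ℝ, EG) G,
    nabla (fundamentalField Y) o (fundamentalField X o) = -fundamentalField ⁅X, Y⁆ o

/-- The Levi-Civita connection of a Riemannian metric: the smooth torsion-free metric linear
connection. -/
structure IsLeviCivita [FiniteDimensional ℝ EB]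
    (metric : ContMDiffRiemannianMetric 𝓘(ℝ, EB) ∞ EB (TangentSpace 𝓘(ℝ, EB) : B → Type _))
    (nabla : CovariantDerivative 𝓘(ℝ, EB) EB (TangentSpace 𝓘(ℝ, EB) : B → Type _)) : Prop where
  smooth : nabla.ContMDiffCovariantDerivative ∞
  torsion_eq_zero : haveI := FiniteDimensional.complete ℝ EB; nabla.torsion = 0
  metric_compatible : ∀ (p : B) (σ τ : Π q : B, TangentSpace 𝓘(ℝ, EB) q),
    MDiffAt (T% σ) p → MDiffAt (T% τ) p → ∀ u : TangentSpace 𝓘(ℝ, EB) p,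
      mvfderiv 𝓘(ℝ, EB) (fun q ↦ metric.inner q (σ q) (τ q)) p u =
        metric.inner p (nabla σ p u) (τ p) + metric.inner p (σ p) (nabla τ p u)

end Homogeneous

/-! ### Connections on the restriction of the ambient tangent bundle to a submanifold -/

section Submanifold

variable {EB : Type*} [NormedAddCommGroup EB] [NormedSpace ℝ EB]
  {B : Type*} [TopologicalSpace B] [ChartedSpace EB B] [IsManifold 𝓘(ℝ, EB) ∞ B]
  {EM : Type*} [NormedAddCommGroup EM] [NormedSpace ℝ EM]
  {M : Type*} [TopologicalSpace M] [ChartedSpace EM M] [IsManifold 𝓘(ℝ, EM) ∞ M]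

/-- The fibres of `E = TB|_M`, the pullback of the tangent bundle of `B` by `ι : M → B`. -/
abbrev AmbientTangent (ι : C^∞⟮𝓘(ℝ, EM), M; 𝓘(ℝ, EB), B⟯) : M → Type _ :=
  (ι : M → B) *ᵖ (TangentSpace 𝓘(ℝ, EB) : B → Type _)

variable {ι : C^∞⟮𝓘(ℝ, EM), M; 𝓘(ℝ, EB), B⟯}

/-- A section of `E` is smooth. -/
def IsSmoothSection (σ : Π x : M, AmbientTangent ι x) : Prop :=
  ContMDiff 𝓘(ℝ, EM) (𝓘(ℝ, EM).prod 𝓘(ℝ, EB)) ∞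
    (fun x ↦ TotalSpace.mk' EB (E := AmbientTangent ι) x (σ x))

/-- A tangent vector field of `M`, seen as a section of `E` through `TM ⊂ E`. -/
def tangentSection (ι : C^∞⟮𝓘(ℝ, EM), M; 𝓘(ℝ, EB), B⟯) (Y : Π x : M, TangentSpace 𝓘(ℝ, EM) x)
    (x : M) : AmbientTangent ι x :=
  mfderiv 𝓘(ℝ, EM) 𝓘(ℝ, EB) ι x (Y x)

/-- The property `P` holds on each closed interval of some subdivision of `[a, b]`. -/
def Piecewise (P : Set ℝ → Prop) (a b : ℝ) : Prop :=
  ∃ (n : ℕ) (t : Fin (n + 1) → ℝ), StrictMono t ∧ t 0 = a ∧ t (Fin.last n) = b ∧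
    ∀ i : Fin n, P (Icc (t i.castSucc) (t i.succ))

variable (EM) in
/-- The curve `c` is piecewise smooth on `[a, b]`. -/
def IsPiecewiseSmooth (c : ℝ → M) (a b : ℝ) : Prop :=
  Piecewise (fun s ↦ ContMDiffOn 𝓘(ℝ, ℝ) 𝓘(ℝ, EM) ∞ c s) a b

variable (D : CovariantDerivative 𝓘(ℝ, EM) EB (AmbientTangent ι))

/-- The section `W` of `E` along the curve `c` is `D`-parallel on `s`: it is differentiable
and `D_{c'} W = 0`. -/
def IsParallelOn (c : ℝ → M) (W : Π t : ℝ, AmbientTangent ι (c t)) (s : Set ℝ) : Prop :=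
  ∀ t ∈ s,
    MDifferentiableWithinAt 𝓘(ℝ, ℝ) (𝓘(ℝ, EM).prod 𝓘(ℝ, EB))
      (fun τ ↦ TotalSpace.mk' EB (E := AmbientTangent ι) (c τ) (W τ)) s t ∧
    covAlong (EN := ℝ) EB D c W s t = 0

/-- The graph of the `D`-parallel transport `τ_c : E_{c(a)} → E_{c(b)}` along a piecewise smooth
curve `c` on `[a, b]`: the relation `τ_c v = w`. -/
def IsParallelTransport (c : ℝ → M) (a b : ℝ) (v : AmbientTangent ι (c a))
    (w : AmbientTangent ι (c b)) : Prop :=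
  ∃ W : Π t : ℝ, AmbientTangent ι (c t), W a = v ∧ W b = w ∧
    Piecewise (fun s ↦ ContMDiffOn 𝓘(ℝ, ℝ) 𝓘(ℝ, EM) ∞ c s ∧ IsParallelOn D c W s) a b

/-- `D` is a `G`-connection: the parallel transport along any piecewise smooth curve in `M` is
`v ↦ (L_g)_* v` for some `g ∈ G`.  The equality with `(L_g)_* v` is one in the total space of
the tangent bundle of `B`. -/
def IsGConnection (G : Type*) [Group G] [MulAction G B] : Prop :=
  ∀ (c : ℝ → M) (a b : ℝ), IsPiecewiseSmooth EM c a b →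
    ∃ g : G, ∀ v : AmbientTangent ι (c a), ∃ w : AmbientTangent ι (c b),
      IsParallelTransport D c a b v w ∧
      (⟨ι (c b), w⟩ : TangentBundle 𝓘(ℝ, EB) B) =
        tangentMap 𝓘(ℝ, EB) 𝓘(ℝ, EB) (fun p : B ↦ g • p) ⟨ι (c a), v⟩

/-- `TM ⊂ E` is a `D`-parallel subbundle: `D_u Y` is tangent to `M` for each smooth tangent vector
field `Y` of `M` and each tangent vector `u` of `M`. -/
def IsTangentParallel : Prop :=
  ∀ Y : Π x : M, TangentSpace 𝓘(ℝ, EM) x, CMDiff ∞ (T% Y) →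
    ∀ (x : M) (u : TangentSpace 𝓘(ℝ, EM) x),
      D (tangentSection ι Y) x u ∈ range (mfderiv 𝓘(ℝ, EM) 𝓘(ℝ, EB) ι x)

/-- For `TM ⊂ E` a `D`-parallel subbundle, the covariant derivative `D_u Y` of a tangent vector
field as a tangent vector of `M`. -/
def tangentDeriv (Y : Π x : M, TangentSpace 𝓘(ℝ, EM) x) (x : M) (u : TangentSpace 𝓘(ℝ, EM) x) :
    TangentSpace 𝓘(ℝ, EM) x :=
  Function.invFun (mfderiv 𝓘(ℝ, EM) 𝓘(ℝ, EB) ι x) (D (tangentSection ι Y) x u)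

/-- For `TM ⊂ E` a `D`-parallel subbundle, the tensor `A : TM → End E` (written as
`A x (σ x) (Y x) = A_Y σ`) is `D`-parallel: `D_u (A_Y σ) = A_{D_u Y} σ + A_Y (D_u σ)` for all smooth
tangent vector fields `Y` of `M`, smooth sections `σ` of `E`, and tangent vectors `u`. -/
def IsParallelTensor
    (A : Π x : M, AmbientTangent ι x →L[ℝ] TangentSpace 𝓘(ℝ, EM) x →L[ℝ] AmbientTangent ι x) :
    Prop :=
  ∀ Y : Π x : M, TangentSpace 𝓘(ℝ, EM) x, CMDiff ∞ (T% Y) →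
    ∀ σ : Π x : M, AmbientTangent ι x, IsSmoothSection σ →
      ∀ (x : M) (u : TangentSpace 𝓘(ℝ, EM) x),
        D (fun y ↦ A y (σ y) (Y y)) x u =
          A x (σ x) (tangentDeriv D Y x u) + A x (D σ x u) (Y x)

/-- For a linear connection `∇` on `B`, the tensor `∇ - D : TM → End E`, as a map `E → Hom(TM, E)`;
`∇` is seen as a connection on `E` by pullback. -/
def diffTensor [FiniteDimensional ℝ EB]
    (nabla : CovariantDerivative 𝓘(ℝ, EB) EB (TangentSpace 𝓘(ℝ, EB) : B → Type _)) (x : M) :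
    AmbientTangent ι x →L[ℝ] TangentSpace 𝓘(ℝ, EM) x →L[ℝ] AmbientTangent ι x :=
  (pullbackConnection nabla ι).difference D x

end Submanifold

end HomStruct

end

/-! Write `T` for the difference of the Levi-Civita and canonical connections, a tensor `TB × TB →
TB` on the ambient manifold. On `M` the two tensors of the statement differ by `T`, restricted to
`E` in one argument and to `TM ⊂ E` in the other: `S_Y σ = Γ_Y σ + T(σ, Y)`. So it suffices that `T`
restricted to `E` is `D`-parallel; as `TM` is a parallel subbundle, restricting the second argument
to `TM` is harmless, and the two parallelism equations then differ by the same quantity on both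
sides (`isParallelTensor_diffTensor_iff`).

`T` is `G`-invariant because both connections are: the canonical one by definition, the Levi-Civita
one because its transport by an isometry is again torsion-free and metric, and such a connection is
unique (`cov_eq_of_torsion_free_of_metric`, `leviCivita_invariant`). Since `D`-parallel transport is
the differential of the action of some group element, it preserves `T`.

Passing from invariance under transport to the Leibniz rule is the analytic part
(`cov_bilinear_of_transport`). In a fixed trivialization, parallel sections along a curve solve `w'
= -A w`, with `A` the connection form evaluated on the velocity. The given transports supply
solutions for all initial values, Grönwall's inequality makes them unique, and together they form a
fundamental solution `P` with `P 0 = 1` and `P' 0 = -A 0`. Invariance reads `T_t(P a, P b) = P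
T_0(a, b)`; differentiating `T_t(s, y) = P T_0(P⁻¹ s, P⁻¹ y)` at `0` gives the Leibniz rule
(`leibniz_of_fundamental_solution`). -/

noncomputable section

set_option linter.unusedSectionVars false

namespace HomStruct

/-! ### Connections and derivatives along maps in an arbitrary trivialization. -/

section Coordinates

variable {EB : Type*} [NormedAddCommGroup EB] [NormedSpace ℝ EB]
  {B : Type*} [TopologicalSpace B] [ChartedSpace EB B]
  {F : Type*} [NormedAddCommGroup F] [NormedSpace ℝ F]
  {V : B → Type*} [TopologicalSpace (TotalSpace F V)]
  [∀ x, AddCommGroup (V x)] [∀ x, Module ℝ (V x)] [∀ x, TopologicalSpace (V x)]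
  [∀ x, IsTopologicalAddGroup (V x)] [∀ x, ContinuousSMul ℝ (V x)]
  [FiberBundle F V] [VectorBundle ℝ F V]
  {EN : Type*} [NormedAddCommGroup EN] [NormedSpace ℝ EN]
  {N : Type*} [TopologicalSpace N] [ChartedSpace EN N]

/-- The local section of `V` with constant coordinates `a` in the trivialization `e`. -/
def frameSection (e : Trivialization F (π F V)) [MemTrivializationAtlas e] (a : F) (y : B) : V y :=
  e.symmL ℝ y a

theorem constSection_eq_frameSection {x : B} (v : V x) :
    constSection F v = frameSection (trivializationAt F V x)
      ((trivializationAt F V x).continuousLinearMapAt ℝ x v) := rfl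

variable (e : Trivialization F (π F V)) [MemTrivializationAtlas e]

theorem coord_frameSection {y : B} (hy : y ∈ e.baseSet) (a : F) :
    e.continuousLinearMapAt ℝ y (frameSection e a y) = a :=
  e.continuousLinearMapAt_symmL hy a

theorem snd_eq_coord {y : B} (hy : y ∈ e.baseSet) (v : V y) :
    (e ⟨y, v⟩).2 = e.continuousLinearMapAt ℝ y v :=
  (congrFun (e.coe_linearMapAt_of_mem (R := ℝ) hy) v).symm

theorem frameSection_add (a b : F) :
    frameSection e (a + b) = frameSection (V := V) e a + frameSection e b := by
  ext y; simp [frameSection]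

theorem frameSection_smul (r : ℝ) (a : F) :
    frameSection e (r • a) = r • frameSection (V := V) e a := by
  ext y; simp [frameSection]

variable [ContMDiffVectorBundle ∞ F V 𝓘(ℝ, EB)]

/-- Differentiability of a map into the total space, in terms of its coordinates. -/
theorem mdifferentiableWithinAt_coord_iff {f : N → B} {W : Π x, V (f x)} {s : Set N} {x : N}
    (hx : f x ∈ e.baseSet) :
    MDifferentiableWithinAt 𝓘(ℝ, EN) (𝓘(ℝ, EB).prod 𝓘(ℝ, F))
      (fun y ↦ TotalSpace.mk' F (f y) (W y)) s x ↔
    MDifferentiableWithinAt 𝓘(ℝ, EN) 𝓘(ℝ, EB) f s x ∧ MDifferentiableWithinAt 𝓘(ℝ, EN) 𝓘(ℝ, F)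
      (fun y ↦ e.continuousLinearMapAt ℝ (f y) (W y)) s x := by
  have : ContMDiffVectorBundle 1 F V 𝓘(ℝ, EB) := .of_le (n := ∞) (by norm_num)
  rw [e.mdifferentiableWithinAt_totalSpace_iff 𝓘(ℝ, EB) _ (e.mem_source.2 hx)]
  refine and_congr_right fun hf ↦ ?_
  refine Filter.EventuallyEq.mdifferentiableWithinAt_iff ?_ (snd_eq_coord e hx (W x)).symm
  filter_upwards [hf.continuousWithinAt.preimage_mem_nhdsWithin
    (e.open_baseSet.mem_nhds hx)] with y hy using (snd_eq_coord e hy (W y)).symm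

theorem mdifferentiableAt_section_coord_iff {σ : Π y, V y} {x : B} (hx : x ∈ e.baseSet) :
    MDiffAt (T% σ) x ↔ MDiffAt (fun y ↦ e.continuousLinearMapAt ℝ y (σ y)) x := by
  rw [← mdifferentiableWithinAt_univ, ← mdifferentiableWithinAt_univ]
  refine (mdifferentiableWithinAt_coord_iff (f := fun y : B ↦ y) e hx).trans ?_
  exact and_iff_right mdifferentiableWithinAt_id

theorem mdifferentiableAt_frameSection {x : B} (hx : x ∈ e.baseSet) (a : F) :
    MDiffAt (T% (frameSection (V := V) e a)) x := by
  rw [mdifferentiableAt_section_coord_iff e hx]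
  refine (mdifferentiableAt_const (c := a)).congr_of_eventuallyEq ?_
  filter_upwards [e.open_baseSet.mem_nhds hx] with y hy using coord_frameSection e hy a

theorem mvfderiv_coord_frameSection {x : B} (hx : x ∈ e.baseSet) (a : F) :
    mvfderiv 𝓘(ℝ, EB) (fun y ↦ e.continuousLinearMapAt ℝ y (frameSection e a y)) x = 0 := by
  have : (fun y ↦ e.continuousLinearMapAt ℝ y (frameSection e a y)) =ᶠ[𝓝 x] fun _ ↦ a := by
    filter_upwards [e.open_baseSet.mem_nhds hx] with y hy using coord_frameSection e hy a
  rw [mvfderiv, this.mfderiv_eq]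
  exact mvfderiv_const a

variable [FiniteDimensional ℝ F] (D : CovariantDerivative 𝓘(ℝ, EB) F V)

/-- The covariant derivative in a trivialization. -/
theorem cov_eq {σ : Π y, V y} {x : B} (hx : x ∈ e.baseSet) (hσ : MDiffAt (T% σ) x) :
    D σ x = (e.symmL ℝ x) ∘L mvfderiv 𝓘(ℝ, EB) (fun y ↦ e.continuousLinearMapAt ℝ y (σ y)) x
      + D (frameSection e (e.continuousLinearMapAt ℝ x (σ x))) x := by
  have : ContMDiffVectorBundle 1 F V 𝓘(ℝ, EB) := .of_le (n := ∞) (by norm_num)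
  -- Both terms obey the same Leibniz rule, so their difference depends on `σ` only through `σ x`;
  -- it is evaluated on the frame section with that value, whose coordinates have zero derivative.
  have tens : TensorialAt 𝓘(ℝ, EB) F (fun σ : Π y, V y ↦ D σ x - (e.symmL ℝ x) ∘L
      mvfderiv 𝓘(ℝ, EB) (fun y ↦ e.continuousLinearMapAt ℝ y (σ y)) x) x := by
    constructor
    · intro f σ hf hσ
      have hc := (mdifferentiableAt_section_coord_iff e hx).1 hσ
      have h1 : (fun y ↦ e.continuousLinearMapAt ℝ y ((f • σ) y)) =
          fun y ↦ f y • e.continuousLinearMapAt ℝ y (σ y) := by ext y; simp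
      rw [h1, D.isCovariantDerivativeOnUniv.leibniz hσ hf, mvfderiv_fun_smul hf hc]
      ext u
      have := e.symmL_continuousLinearMapAt (R := ℝ) hx (σ x)
      simp only [ContinuousLinearMap.comp_apply, _root_.add_apply, _root_.smul_apply,
        _root_.sub_apply, ContinuousLinearMap.smulRight_apply, map_add, map_smul, this, smul_sub]
      abel
    · intro σ σ' hσ hσ'
      have hc := (mdifferentiableAt_section_coord_iff e hx).1 hσ
      have hc' := (mdifferentiableAt_section_coord_iff e hx).1 hσ'
      have h1 : (fun y ↦ e.continuousLinearMapAt ℝ y ((σ + σ') y)) =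
          fun y ↦ e.continuousLinearMapAt ℝ y (σ y) + e.continuousLinearMapAt ℝ y (σ' y) := by
        ext y; simp
      rw [h1, D.isCovariantDerivativeOnUniv.add hσ hσ', mvfderiv_fun_add hc hc']
      ext u
      simp only [ContinuousLinearMap.comp_apply, _root_.add_apply, _root_.sub_apply, map_add]
      abel
  have key := tens.pointwise hσ
    (mdifferentiableAt_frameSection e hx (e.continuousLinearMapAt ℝ x (σ x)))
    (e.symmL_continuousLinearMapAt (R := ℝ) hx (σ x)).symm
  simp only [mvfderiv_coord_frameSection e hx, ContinuousLinearMap.comp_zero, sub_zero] at key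
  rw [← key]; abel

/-! ### Product and chain rules for vector valued functions -/

theorem mvfderivWithin_clm_apply {F' : Type*} [NormedAddCommGroup F'] [NormedSpace ℝ F']
    {A : N → F →L[ℝ] F'} {h : N → F} {s : Set N} {x : N}
    (hA : MDifferentiableWithinAt 𝓘(ℝ, EN) 𝓘(ℝ, F →L[ℝ] F') A s x)
    (hh : MDifferentiableWithinAt 𝓘(ℝ, EN) 𝓘(ℝ, F) h s x)
    (hs : UniqueMDiffWithinAt 𝓘(ℝ, EN) s x) (u : TangentSpace 𝓘(ℝ, EN) x) :
    mvfderivWithin 𝓘(ℝ, EN) (fun y ↦ A y (h y)) s x u =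
      mvfderivWithin 𝓘(ℝ, EN) A s x u (h x) + A x (mvfderivWithin 𝓘(ℝ, EN) h s x u) := by
  have key : HasMFDerivWithinAt 𝓘(ℝ, EN) 𝓘(ℝ, F') (fun y ↦ A y (h y)) s x
      ((A x).comp (show EN →L[ℝ] F from mvfderivWithin 𝓘(ℝ, EN) h s x) +
        (show EN →L[ℝ] F →L[ℝ] F' from mvfderivWithin 𝓘(ℝ, EN) A s x).flip (h x)) := by
    refine ⟨hA.continuousWithinAt.clm_apply hh.continuousWithinAt, ?_⟩
    simpa using! hA.hasMFDerivWithinAt.2.clm_apply hh.hasMFDerivWithinAt.2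
  have := congrArg (fun L : EN →L[ℝ] F' ↦ L u) (key.mfderivWithin hs)
  refine this.trans ?_
  exact add_comm _ _

theorem mvfderivWithin_comp_vector {g : B → F} {f : N → B} {s : Set N} {x : N}
    (hg : MDiffAt g (f x)) (hf : MDifferentiableWithinAt 𝓘(ℝ, EN) 𝓘(ℝ, EB) f s x)
    (hs : UniqueMDiffWithinAt 𝓘(ℝ, EN) s x) :
    mvfderivWithin 𝓘(ℝ, EN) (fun y ↦ g (f y)) s x =
      (mvfderiv 𝓘(ℝ, EB) g (f x)).comp (mfderivWithin 𝓘(ℝ, EN) 𝓘(ℝ, EB) f s x) :=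
  mfderiv_comp_mfderivWithin x hg hf hs

variable {f : N → B} {s : Set N} {x : N}

/-- The covariant derivative along a map in a trivialization. -/
theorem covAlong_eq {W : Π y, V (f y)} (hx : f x ∈ e.baseSet)
    (hs : UniqueMDiffWithinAt 𝓘(ℝ, EN) s x)
    (hW : MDifferentiableWithinAt 𝓘(ℝ, EN) (𝓘(ℝ, EB).prod 𝓘(ℝ, F))
      (fun y ↦ TotalSpace.mk' F (f y) (W y)) s x) :
    covAlong F D f W s x =
      (e.symmL ℝ (f x)) ∘L
        mvfderivWithin 𝓘(ℝ, EN) (fun y ↦ e.continuousLinearMapAt ℝ (f y) (W y)) s x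
      + D (frameSection e (e.continuousLinearMapAt ℝ (f x) (W x))) (f x) ∘L
        mfderivWithin 𝓘(ℝ, EN) 𝓘(ℝ, EB) f s x := by
  have : ContMDiffVectorBundle 1 F V 𝓘(ℝ, EB) := .of_le (n := ∞) (by norm_num)
  set e' := trivializationAt F V (f x) with he'
  have hx' : f x ∈ e'.baseSet := FiberBundle.mem_baseSet_trivializationAt' (f x)
  obtain ⟨hf, hWe⟩ := (mdifferentiableWithinAt_coord_iff e hx).1 hW
  have hWe' := ((mdifferentiableWithinAt_coord_iff e' hx').1 hW).2
  -- `covAlong` uses the trivialization at `f x`, which changes along a curve, whereas a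
  -- differential equation needs a fixed one. The change of frame `φ` contributes a `dφ` term twice:
  -- in the derivative of the coordinates and, by `hc`, in `D` of the constant section. These
  -- contributions match.
  let φ : B → F →L[ℝ] F := fun z ↦ e'.coordChangeL ℝ e z
  have hφ : MDiffAt φ (f x) := mdifferentiableAt_coordChangeL hx' hx
  have hφe : ∀ z ∈ e'.baseSet ∩ e.baseSet, ∀ a,
      φ z a = e.continuousLinearMapAt ℝ z (e'.symmL ℝ z a) := by
    intro z hz a
    rw [← snd_eq_coord e hz.2]
    rw [e'.symmL_apply hz.1]
    exact e'.coordChangeL_apply (R := ℝ) e hz a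
  have hnear : e'.baseSet ∩ e.baseSet ∈ 𝓝 (f x) :=
    (e'.open_baseSet.inter e.open_baseSet).mem_nhds ⟨hx', hx⟩
  have h1 : mvfderivWithin 𝓘(ℝ, EN) (fun y ↦ e.continuousLinearMapAt ℝ (f y) (W y)) s x =
      mvfderivWithin 𝓘(ℝ, EN)
        (fun y ↦ φ (f y) (e'.continuousLinearMapAt ℝ (f y) (W y))) s x := by
    refine Filter.EventuallyEq.mfderivWithin_eq ?_ ?_
    · filter_upwards [hf.continuousWithinAt.preimage_mem_nhdsWithin hnear] with y hy
      rw [hφe _ hy, e'.symmL_continuousLinearMapAt hy.1]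
    · rw [hφe _ ⟨hx', hx⟩, e'.symmL_continuousLinearMapAt hx']
  have hc : ∀ u, D (constSection F (W x)) (f x) u =
      e.symmL ℝ (f x) (mvfderiv 𝓘(ℝ, EB) φ (f x) u (e'.continuousLinearMapAt ℝ (f x) (W x)))
      + D (frameSection e (e.continuousLinearMapAt ℝ (f x) (W x))) (f x) u := by
    intro u
    rw [cov_eq e D hx (mdifferentiableAt_constSection (W x)), show constSection F (W x) =
      frameSection e' (e'.continuousLinearMapAt ℝ (f x) (W x)) from rfl, _root_.add_apply, ContinuousLinearMap.comp_apply]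
    congr 2
    · have h2 : mvfderiv 𝓘(ℝ, EB) (fun z ↦ e.continuousLinearMapAt ℝ z
          (frameSection e' (e'.continuousLinearMapAt ℝ (f x) (W x)) z)) (f x) =
        mvfderivWithin 𝓘(ℝ, EB) (fun z ↦ φ z (e'.continuousLinearMapAt ℝ (f x) (W x)))
          univ (f x) := by
        rw [mvfderivWithin_univ]
        refine Filter.EventuallyEq.mfderiv_eq ?_
        filter_upwards [hnear] with z hz using (hφe z hz _).symm
      rw [h2, mvfderivWithin_clm_apply (N := B) hφ.mdifferentiableWithinAt
        mdifferentiableWithinAt_const (uniqueMDiffWithinAt_univ _), mvfderivWithin_const]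
      simp
    · rw [show frameSection e' (e'.continuousLinearMapAt ℝ (f x) (W x)) (f x) = W x from
        e'.symmL_continuousLinearMapAt hx' _]
  ext u
  have h3 := mvfderivWithin_clm_apply (A := fun y ↦ φ (f y))
    (hφ.comp_mdifferentiableWithinAt x hf) hWe' hs u
  rw [h1]
  simp only [covAlong, _root_.add_apply, ContinuousLinearMap.comp_apply, ← he', hc, h3,
    mvfderivWithin_comp_vector hφ hf hs, map_add, hφe _ ⟨hx', hx⟩,
    e.symmL_continuousLinearMapAt hx]
  abel

/-- The covariant derivative along `f` of the restriction `σ ∘ f` of a section `σ`. -/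
theorem covAlong_comp {σ : Π y, V y} (hs : UniqueMDiffWithinAt 𝓘(ℝ, EN) s x)
    (hf : MDifferentiableWithinAt 𝓘(ℝ, EN) 𝓘(ℝ, EB) f s x) (hσ : MDiffAt (T% σ) (f x)) :
    covAlong F D f (fun y ↦ σ (f y)) s x =
      D σ (f x) ∘L mfderivWithin 𝓘(ℝ, EN) 𝓘(ℝ, EB) f s x := by
  have hx := FiberBundle.mem_baseSet_trivializationAt' (F := F) (E := V) (f x)
  rw [cov_eq (trivializationAt F V (f x)) D hx hσ]
  have := mvfderivWithin_comp_vector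
    ((mdifferentiableAt_section_coord_iff (trivializationAt F V (f x)) hx).1 hσ) hf hs
  rw [covAlong, this, constSection_eq_frameSection]
  rfl

end Coordinates

/-! ### Subdivisions and linear differential equations -/

section LinearODE

theorem exists_mem_Ico_of_subdivision {n : ℕ} {τ : Fin (n + 1) → ℝ} {a b t : ℝ} (h0 : τ 0 = a)
    (hn : τ (Fin.last n) = b) (ht : t ∈ Ico a b) :
    ∃ i : Fin n, t ∈ Ico (τ i.castSucc) (τ i.succ) := by
  induction n generalizing b with
  | zero =>
    have : (Fin.last 0 : Fin 1) = 0 := rfl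
    rw [this, h0] at hn
    exact absurd (ht.1.trans_lt ht.2) (by simp [hn])
  | succ n ih =>
    rcases lt_or_ge t (τ (Fin.last n).castSucc) with h | h
    · obtain ⟨i, hi⟩ := ih (τ := fun i ↦ τ i.castSucc) (by simpa using h0) rfl ⟨ht.1, h⟩
      exact ⟨i.castSucc, by simpa using hi⟩
    · exact ⟨Fin.last n, h, by simpa [hn] using ht.2⟩

theorem exists_mem_Ioc_of_subdivision {n : ℕ} {τ : Fin (n + 1) → ℝ} {a b t : ℝ} (h0 : τ 0 = a)
    (hn : τ (Fin.last n) = b) (ht : t ∈ Ioc a b) :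
    ∃ i : Fin n, t ∈ Ioc (τ i.castSucc) (τ i.succ) := by
  induction n generalizing b with
  | zero =>
    have : (Fin.last 0 : Fin 1) = 0 := rfl
    rw [this, h0] at hn
    exact absurd (ht.1.trans_le ht.2) (by simp [hn])
  | succ n ih =>
    rcases le_or_gt t (τ (Fin.last n).castSucc) with h | h
    · obtain ⟨i, hi⟩ := ih (τ := fun i ↦ τ i.castSucc) (by simpa using h0) rfl ⟨ht.1, h⟩
      exact ⟨i.castSucc, by simpa using hi⟩
    · exact ⟨Fin.last n, h, by simpa [hn] using ht.2⟩

theorem Piecewise.mono {P Q : Set ℝ → Prop} {a b : ℝ} (h : Piecewise P a b)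
    (hPQ : ∀ r s, a ≤ r → r < s → s ≤ b → P (Icc r s) → Q (Icc r s)) : Piecewise Q a b := by
  obtain ⟨n, τ, hτ, h0, hn, hP⟩ := h
  refine ⟨n, τ, hτ, h0, hn, fun i ↦ hPQ _ _ ?_ (hτ i.castSucc_lt_succ) ?_ (hP i)⟩
  · exact h0 ▸ hτ.monotone (Fin.zero_le _)
  · exact hn ▸ hτ.monotone (Fin.le_last _)

variable {F : Type*} [NormedAddCommGroup F] [NormedSpace ℝ F]

/-- `w` solves `w' = -A w` on `[a, b]`, in the sense of right derivatives. -/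
def IsRightSolution (A : ℝ → F →L[ℝ] F) (w : ℝ → F) (a b : ℝ) : Prop :=
  ContinuousOn w (Icc a b) ∧ ∀ t ∈ Ico a b, HasDerivWithinAt w (-(A t (w t))) (Ici t) t

/-- At a division point the two one-sided derivatives come from different pieces. The piece to the
right gives the right derivative; continuity needs both neighbours. -/
theorem isRightSolution_of_piecewise {A : ℝ → F →L[ℝ] F} {w : ℝ → F} {a b : ℝ}
    (h : Piecewise (fun s ↦ ∀ t ∈ s, HasDerivWithinAt w (-(A t (w t))) s t) a b) :
    IsRightSolution A w a b := by
  obtain ⟨n, τ, hτ, h0, hn, hP⟩ := h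
  have hr : ∀ t ∈ Ico a b, HasDerivWithinAt w (-(A t (w t))) (Ici t) t := by
    intro t ht
    obtain ⟨i, hi⟩ := exists_mem_Ico_of_subdivision h0 hn ht
    refine (hP i t ⟨hi.1, hi.2.le⟩).mono_of_mem_nhdsWithin ?_
    exact Filter.mem_of_superset (Icc_mem_nhdsGE hi.2) (Icc_subset_Icc_left hi.1)
  have hl : ∀ t ∈ Ioc a b, ContinuousWithinAt w (Iic t) t := by
    intro t ht
    obtain ⟨i, hi⟩ := exists_mem_Ioc_of_subdivision h0 hn ht
    refine (hP i t ⟨hi.1.le, hi.2⟩).continuousWithinAt.mono_of_mem_nhdsWithin ?_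
    exact Filter.mem_of_superset (Icc_mem_nhdsLE hi.1) (Icc_subset_Icc_right hi.2)
  refine ⟨fun t ht ↦ ?_, hr⟩
  rw [← Icc_union_Icc_eq_Icc ht.1 ht.2]
  refine ContinuousWithinAt.union ?_ ?_
  · rcases ht.1.eq_or_lt with h | h
    · subst h; simp [continuousWithinAt_singleton]
    · exact (hl t ⟨h, ht.2⟩).mono fun _ h ↦ h.2
  · rcases ht.2.eq_or_lt with h | h
    · subst h; simp [continuousWithinAt_singleton]
    · exact (hr t ⟨ht.1, h⟩).continuousWithinAt.mono fun _ h ↦ h.1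

theorem IsRightSolution.mono {A : ℝ → F →L[ℝ] F} {w : ℝ → F} {a b c : ℝ}
    (h : IsRightSolution A w a b) (hc : c ≤ b) : IsRightSolution A w a c :=
  ⟨h.1.mono (Icc_subset_Icc_right hc), fun t ht ↦ h.2 t ⟨ht.1, ht.2.trans_le hc⟩⟩

/-- Grönwall: the bound on `A` makes the right-hand side `K`-Lipschitz in the unknown. -/
theorem IsRightSolution.eqOn {A : ℝ → F →L[ℝ] F} {w w' : ℝ → F} {a b : ℝ} {K : NNReal}
    (hA : ∀ t ∈ Icc a b, ‖A t‖ ≤ K) (h : IsRightSolution A w a b)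
    (h' : IsRightSolution A w' a b) (h0 : w a = w' a) : EqOn w w' (Icc a b) := by
  refine ODE_solution_unique_of_mem_Icc_right (v := fun t x ↦ -(A t x)) (s := fun _ ↦ univ) (K := K)
    (fun t ht ↦ ?_) h.1 h.2 (fun _ _ ↦ mem_univ _) h'.1 h'.2 (fun _ _ ↦ mem_univ _) h0
  have := ContinuousLinearMap.lipschitzWith_of_opNorm_le (f := -(A t)) (K := K)
    (by simpa using hA t ⟨ht.1, ht.2.le⟩)
  exact this.lipschitzOnWith

variable [FiniteDimensional ℝ F]

/-- The solutions of `w' = -A w` with initial values a basis give a fundamental solution. -/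
theorem exists_fundamental_solution {A : ℝ → F →L[ℝ] F} {ε : ℝ} (hε : 0 < ε) {K : NNReal}
    (hA : ∀ t ∈ Icc 0 ε, ‖A t‖ ≤ K)
    (hsol : ∀ v : F, ∃ w : ℝ → F, w 0 = v ∧ IsRightSolution A w 0 ε) :
    ∃ P : ℝ → F →L[ℝ] F, P 0 = ContinuousLinearMap.id ℝ F ∧
      HasDerivWithinAt P (-(A 0)) (Ici 0) 0 ∧
      ∀ t ∈ Icc 0 ε, ∀ w : ℝ → F, IsRightSolution A w 0 t → w t = P t (w 0) := by
  choose w hw0 hw using hsol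
  let b := Module.finBasis ℝ F
  let l : Fin (Module.finrank ℝ F) → F →L[ℝ] ℝ := fun i ↦ (b.coord i).toContinuousLinearMap
  have hl : ∀ v, ∑ i, l i v • b i = v := fun v ↦ b.sum_repr v
  -- Only the solutions starting at basis vectors are used, so `P t` is linear by construction;
  -- uniqueness then identifies `P t v` with any solution starting at `v`.
  let P : ℝ → F →L[ℝ] F := fun t ↦ ∑ i, (l i).smulRight (w (b i) t)
  have hPapply : ∀ t v, P t v = ∑ i, l i v • w (b i) t := by
    intro t v; simp [P]
  have hP0 : P 0 = ContinuousLinearMap.id ℝ F := by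
    ext v; rw [hPapply]; simp only [hw0]; exact hl v
  have hPsol : ∀ v, IsRightSolution A (fun t ↦ P t v) 0 ε := by
    intro v
    simp only [hPapply]
    refine ⟨continuousOn_finsetSum _ fun i _ ↦ (hw (b i)).1.const_smul (l i v), fun t ht ↦ ?_⟩
    have := HasDerivWithinAt.fun_sum (u := Finset.univ)
      fun i _ ↦ ((hw (b i)).2 t ht).const_smul (l i v)
    refine this.congr_deriv ?_
    simp [map_sum, Finset.sum_neg_distrib]
  refine ⟨P, hP0, ?_, fun t ht w' hw' ↦ ?_⟩
  · have h1 := HasDerivWithinAt.fun_sum (u := Finset.univ) fun i _ ↦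
      ((ContinuousLinearMap.smulRightL ℝ F F (l i)).hasFDerivAt.comp_hasDerivWithinAt (0 : ℝ)
        ((hw (b i)).2 0 ⟨le_rfl, hε⟩))
    refine h1.congr_deriv ?_
    ext v
    simp only [hw0]
    rw [_root_.sum_apply]
    simp only [ContinuousLinearMap.smulRightL_apply_apply, ContinuousLinearMap.smulRight_apply, smul_neg,
      Finset.sum_neg_distrib, _root_.neg_apply, ← map_smul, ← map_sum, hl]
  · refine IsRightSolution.eqOn (A := A) (K := K)
      (fun s hs ↦ hA s ⟨hs.1, hs.2.trans ht.2⟩) hw' ((hPsol (w' 0)).mono ht.2)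
      (by simp [hP0]) ⟨ht.1, le_rfl⟩

/-- The Leibniz rule for a bilinear map transported by a fundamental solution. -/
theorem leibniz_of_fundamental_solution {P : ℝ → F →L[ℝ] F} {A : F →L[ℝ] F}
    (hP0 : P 0 = ContinuousLinearMap.id ℝ F) (hP : HasDerivWithinAt P (-A) (Ici 0) 0)
    {T : ℝ → F → F → F} {B : F →L[ℝ] F →L[ℝ] F}
    (hT : ∀ᶠ t in 𝓝[≥] (0 : ℝ), ∀ a b, T t (P t a) (P t b) = P t (B a b))
    {s y : ℝ → F} {s' y' z' : F} (hs : HasDerivWithinAt s s' (Ici 0) 0)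
    (hy : HasDerivWithinAt y y' (Ici 0) 0)
    (hz : HasDerivWithinAt (fun t ↦ T t (s t) (y t)) z' (Ici 0) 0) :
    z' + A (B (s 0) (y 0)) = B (s' + A (s 0)) (y 0) + B (s 0) (y' + A (y 0)) := by
  -- `P t` is known to be invertible only near `0`; `Ring.inverse` is total and differentiable at
  -- the identity, so `Q' 0 = -P' 0 = A`.
  let Q : ℝ → F →L[ℝ] F := fun t ↦ Ring.inverse (P t)
  have hQ0 : Q 0 = ContinuousLinearMap.id ℝ F := by
    simp only [Q, hP0]; exact Ring.inverse_one _
  have hQ : HasDerivWithinAt Q A (Ici 0) 0 := by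
    have h1 := hasFDerivAt_ringInverse (𝕜 := ℝ) (1 : (F →L[ℝ] F)ˣ)
    have h2 := HasFDerivAt.comp_hasDerivWithinAt (0 : ℝ) (f := P) (s := Ici 0)
      (l := Ring.inverse) (by rw [hP0]; exact h1) hP
    refine h2.congr_deriv ?_
    change -((↑(1⁻¹ : (F →L[ℝ] F)ˣ) : F →L[ℝ] F) * (-A) * ↑(1⁻¹ : (F →L[ℝ] F)ˣ)) = A
    rw [inv_one, Units.val_one, one_mul, mul_one, neg_neg]
  have hunit : ∀ᶠ t in 𝓝[≥] (0 : ℝ), IsUnit (P t) := by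
    refine hP.continuousWithinAt.eventually ?_
    rw [hP0]
    exact (Units.isOpen (R := F →L[ℝ] F)).mem_nhds isUnit_one
  -- No regularity of `T` in `t` is assumed: near `0` invariance expresses it through `P`, `Q` and
  -- the fixed bilinear map `B`, so the product rule applies.
  have hev : (fun t ↦ T t (s t) (y t)) =ᶠ[𝓝[≥] (0 : ℝ)]
      fun t ↦ P t (B (Q t (s t)) (Q t (y t))) := by
    filter_upwards [hT, hunit] with t ht hu
    have h1 : ∀ v, P t (Q t v) = v := fun v ↦
      congrArg (fun L : F →L[ℝ] F ↦ L v) (Ring.mul_inverse_cancel _ hu)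
    rw [← ht, h1, h1]
  have hz2 : HasDerivWithinAt (fun t ↦ P t (B (Q t (s t)) (Q t (y t)))) z' (Ici 0) 0 :=
    hz.congr_of_eventuallyEq hev.symm (hev.self_of_nhdsWithin self_mem_Ici).symm
  have hz3 := hP.clm_apply ((B.hasFDerivAt.comp_hasDerivWithinAt (0 : ℝ)
    (hQ.clm_apply hs)).clm_apply (hQ.clm_apply hy))
  have := (uniqueDiffWithinAt_Ici (0 : ℝ)).eq_deriv _ hz2 hz3
  rw [this]
  simp only [hP0, hQ0, Function.comp_apply, ContinuousLinearMap.id_apply,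
    _root_.neg_apply, map_add, _root_.add_apply]
  abel

end LinearODE

/-! ### The connection form along a curve. -/

section ParallelCurve

variable {EB : Type*} [NormedAddCommGroup EB] [NormedSpace ℝ EB]
  {B : Type*} [TopologicalSpace B] [ChartedSpace EB B]
  {F : Type*} [NormedAddCommGroup F] [NormedSpace ℝ F]
  {V : B → Type*} [TopologicalSpace (TotalSpace F V)]
  [∀ x, AddCommGroup (V x)] [∀ x, Module ℝ (V x)] [∀ x, TopologicalSpace (V x)]
  [∀ x, IsTopologicalAddGroup (V x)] [∀ x, ContinuousSMul ℝ (V x)]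
  [FiberBundle F V] [VectorBundle ℝ F V] [ContMDiffVectorBundle ∞ F V 𝓘(ℝ, EB)]

/-- Near each point, the constant coordinate sections extend to global smooth sections. -/
theorem exists_smooth_frameSection [FiniteDimensional ℝ EB] [T2Space B] [IsManifold 𝓘(ℝ, EB) ∞ B]
    (x : B) :
    ∃ S : F → Π y, V y, (∀ a, CMDiff ∞ (T% (S a))) ∧
      ∀ᶠ y in 𝓝 x, ∀ a, S a y = frameSection (trivializationAt F V x) a y := by
  set e := trivializationAt F V x
  have hx : e.baseSet ∈ 𝓝 x :=
    e.open_baseSet.mem_nhds (FiberBundle.mem_baseSet_trivializationAt' x)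
  -- Smoothness of a connection and invariance of the canonical one are used on globally smooth
  -- sections, hence the cut-off by a bump function supported in the base set.
  obtain ⟨ρ, -, hρ⟩ := (SmoothBumpFunction.nhds_basis_tsupport (I := 𝓘(ℝ, EB)) x).mem_iff.1 hx
  refine ⟨fun a ↦ (ρ : B → ℝ) • frameSection e a, fun a ↦ ?_, ?_⟩
  · refine ContMDiffOn.smul_section_of_tsupport ρ.contMDiff.contMDiffOn e.open_baseSet hρ ?_
    rw [e.contMDiffOn_section_baseSet_iff]
    refine (contMDiffOn_const (c := a)).congr fun y hy ↦ ?_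
    rw [snd_eq_coord e hy, coord_frameSection e hy]
  · filter_upwards [ρ.eventuallyEq_one] with y hy a
    simp [hy, e]

variable [FiniteDimensional ℝ F] (e : Trivialization F (π F V)) [MemTrivializationAtlas e]
  (D : CovariantDerivative 𝓘(ℝ, EB) F V)

open scoped Classical in
/-- The matrix of the connection form in the trivialization `e`. -/
def connectionMatrix (y : B) (u : TangentSpace 𝓘(ℝ, EB) y) : F →L[ℝ] F :=
  -- Linearity in `a` needs the frame sections to be differentiable at `y`, which is known over the
  -- base set; elsewhere the value is the default `0`.
  if hy : y ∈ e.baseSet then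
    LinearMap.toContinuousLinearMap
      { toFun := fun a ↦ e.continuousLinearMapAt ℝ y (D (frameSection e a) y u)
        map_add' := fun a b ↦ by
          rw [frameSection_add, D.isCovariantDerivativeOnUniv.add
            (mdifferentiableAt_frameSection e hy a) (mdifferentiableAt_frameSection e hy b),
            _root_.add_apply, map_add]
        map_smul' := fun r a ↦ by
          rw [frameSection_smul, D.isCovariantDerivativeOnUniv.smul_const _
            (mdifferentiableAt_frameSection e hy a), _root_.smul_apply, map_smul,
            RingHom.id_apply] }
  else 0

theorem connectionMatrix_apply {y : B} (hy : y ∈ e.baseSet) (u : TangentSpace 𝓘(ℝ, EB) y) (a : F) :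
    connectionMatrix e D y u a = e.continuousLinearMapAt ℝ y (D (frameSection e a) y u) := by
  simp [connectionMatrix, hy]

/-- The unit tangent vector of the line. -/
def unitTangent (t : ℝ) : TangentSpace 𝓘(ℝ, ℝ) t := (1 : ℝ)

variable (EB) in
/-- The velocity of a curve. -/
def velocity (c : ℝ → B) (t : ℝ) : TangentSpace 𝓘(ℝ, EB) (c t) :=
  mfderiv 𝓘(ℝ, ℝ) 𝓘(ℝ, EB) c t (unitTangent t)

/-- The derivative of the coordinates of a section along a curve. -/
theorem hasDerivWithinAt_coord {c : ℝ → B} {W : Π t, V (c t)} {s : Set ℝ} {t : ℝ}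
    (hct : c t ∈ e.baseSet) (hs : UniqueDiffWithinAt ℝ s t)
    (hc : MDifferentiableAt 𝓘(ℝ, ℝ) 𝓘(ℝ, EB) c t)
    (hW : MDifferentiableWithinAt 𝓘(ℝ, ℝ) (𝓘(ℝ, EB).prod 𝓘(ℝ, F))
      (fun τ ↦ TotalSpace.mk' F (c τ) (W τ)) s t) :
    HasDerivWithinAt (fun τ ↦ e.continuousLinearMapAt ℝ (c τ) (W τ))
      (e.continuousLinearMapAt ℝ (c t) (covAlong (EN := ℝ) F D c W s t (unitTangent t)) -
        connectionMatrix e D (c t) (velocity EB c t)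
          (e.continuousLinearMapAt ℝ (c t) (W t))) s t := by
  have hs' : UniqueMDiffWithinAt 𝓘(ℝ, ℝ) s t := uniqueMDiffWithinAt_iff_uniqueDiffWithinAt.2 hs
  have hd := ((mdifferentiableWithinAt_coord_iff e hct).1 hW).2
  have h1 := (mdifferentiableWithinAt_iff_differentiableWithinAt.1 hd).hasDerivWithinAt
  refine h1.congr_deriv ?_
  -- In the frame of `e` the derivative along `c` is `w' + A w`, which is solved for `w'`.
  rw [covAlong_eq e D hct hs' hW, mfderivWithin_eq_mfderiv hs' hc, velocity, connectionMatrix_apply e D hct]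
  simp only [_root_.add_apply, ContinuousLinearMap.comp_apply, map_add,
    e.continuousLinearMapAt_symmL hct, add_sub_cancel_right]
  rw [mvfderivWithin, mfderivWithin_eq_fderivWithin]
  rfl

theorem contMDiffOn_velocity [IsManifold 𝓘(ℝ, EB) ∞ B] {c : ℝ → B} {s : Set ℝ} (hs : IsOpen s)
    (hc : ContMDiffOn 𝓘(ℝ, ℝ) 𝓘(ℝ, EB) ∞ c s) :
    ContMDiffOn 𝓘(ℝ, ℝ) 𝓘(ℝ, EB).tangent ∞
      (fun t ↦ TotalSpace.mk' EB (E := TangentSpace 𝓘(ℝ, EB)) (c t) (velocity EB c t)) s := by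
  have : IsManifold 𝓘(ℝ, EB) 1 B := .of_le (n := ∞) (by norm_num)
  have h1 : ContMDiff 𝓘(ℝ, ℝ) 𝓘(ℝ, ℝ).tangent ∞
      (fun t ↦ TotalSpace.mk' ℝ (E := TangentSpace 𝓘(ℝ, ℝ)) t (unitTangent t)) :=
    contMDiff_vectorSpace_iff_contDiff.2 contDiff_const
  have h2 := (hc.contMDiffOn_tangentMapWithin (m := ∞) (by simp) hs.uniqueMDiffOn).comp
    h1.contMDiffOn (fun t ht ↦ ht)
  refine h2.congr fun t ht ↦ ?_
  simp only [Function.comp_apply, tangentMapWithin, mfderivWithin_of_isOpen hs ht]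
  rfl

/-- In finite dimension it is enough to fix a vector `a`: the frame section of `a` extends to a
smooth section, and its covariant derivative contracted with the velocity is smooth. Continuity at
`0` yields the bound on `A` near `0` that uniqueness requires. -/
theorem continuousAt_connectionMatrix [FiniteDimensional ℝ EB] [T2Space B]
    [IsManifold 𝓘(ℝ, EB) ∞ B] (hD : D.ContMDiffCovariantDerivative ∞) {c : ℝ → B} {δ : ℝ}
    (hδ : 0 < δ) (hc : ContMDiffOn 𝓘(ℝ, ℝ) 𝓘(ℝ, EB) ∞ c (Ioo (-δ) δ)) :
    ContinuousAt (fun t ↦ connectionMatrix (trivializationAt F V (c 0)) D (c t)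
      (velocity EB c t)) 0 := by
  set e := trivializationAt F V (c 0)
  have h0 : Ioo (-δ) δ ∈ 𝓝 (0 : ℝ) := Ioo_mem_nhds (by linarith) hδ
  have hc0 : ContinuousAt c 0 := (hc.continuousOn.continuousAt h0)
  have hbase : ∀ᶠ y in 𝓝 (c 0), y ∈ e.baseSet :=
    e.open_baseSet.mem_nhds (FiberBundle.mem_baseSet_trivializationAt' (c 0))
  rw [continuousAt_clm_apply]
  intro a
  obtain ⟨S, hS, hSe⟩ := exists_smooth_frameSection (F := F) (V := V) (EB := EB) (c 0)
  have hDS : ContMDiffAt 𝓘(ℝ, EB) (𝓘(ℝ, EB).prod 𝓘(ℝ, EB →L[ℝ] F)) ∞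
      (fun y ↦ TotalSpace.mk' (EB →L[ℝ] F) (E := fun y ↦ TangentSpace 𝓘(ℝ, EB) y →L[ℝ] V y) y
        (D (S a) y)) (c 0) :=
    (hD.contMDiff.contMDiff (σ := S a) (hS a).contMDiffOn).contMDiffAt Filter.univ_mem
  have hctan : ContMDiffAt 𝓘(ℝ, ℝ) 𝓘(ℝ, EB).tangent ∞
      (fun t ↦ TotalSpace.mk' EB (E := TangentSpace 𝓘(ℝ, EB)) (c t)
        (velocity EB c t)) 0 :=
    (contMDiffOn_velocity isOpen_Ioo hc).contMDiffAt h0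
  have h1 := (hDS.comp (0 : ℝ) (hc.contMDiffAt h0)).clm_bundle_apply
    (F₁ := EB) (E₁ := fun y ↦ TangentSpace 𝓘(ℝ, EB) y) (E₂ := V) hctan
  have h2 := (contMDiffAt_totalSpace.1 h1).2.continuousAt
  refine h2.congr ?_
  -- Agreement of the two sections at `c t` alone would not suffice; `eventually_nhds` gives it on a
  -- neighbourhood of `c t`, so the covariant derivatives coincide.
  filter_upwards [hc0.eventually hbase, hc0.eventually hSe.eventually_nhds] with t ht htS
  rw [connectionMatrix_apply e D ht]
  refine (snd_eq_coord e ht _).trans ?_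
  congr 2
  refine D.isCovariantDerivativeOnUniv.congr_of_eventuallyEq ?_ ?_ Filter.univ_mem ?_
  · exact (hS a).contMDiffAt.mdifferentiableAt (by simp)
  · exact mdifferentiableAt_frameSection e ht a
  · exact htS.mono fun y hy ↦ hy a

end ParallelCurve

/-! ### From invariance under transport to the Leibniz rule. -/

section TransportedTensor

variable {EB : Type*} [NormedAddCommGroup EB] [NormedSpace ℝ EB]
  {B : Type*} [TopologicalSpace B] [ChartedSpace EB B]
  {F : Type*} [NormedAddCommGroup F] [NormedSpace ℝ F]
  {V : B → Type*} [TopologicalSpace (TotalSpace F V)]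
  [∀ x, AddCommGroup (V x)] [∀ x, Module ℝ (V x)] [∀ x, TopologicalSpace (V x)]
  [∀ x, IsTopologicalAddGroup (V x)] [∀ x, ContinuousSMul ℝ (V x)]
  [FiberBundle F V] [VectorBundle ℝ F V] [ContMDiffVectorBundle ∞ F V 𝓘(ℝ, EB)]
  [FiniteDimensional ℝ F] [FiniteDimensional ℝ EB] [T2Space B] [IsManifold 𝓘(ℝ, EB) ∞ B]
  (D : CovariantDerivative 𝓘(ℝ, EB) F V)

/-- `W` is a `D`-parallel section along the curve `c` on `s`. -/
def IsParallelAlong (c : ℝ → B) (W : Π t : ℝ, V (c t)) (s : Set ℝ) : Prop :=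
  ∀ t ∈ s,
    MDifferentiableWithinAt 𝓘(ℝ, ℝ) (𝓘(ℝ, EB).prod 𝓘(ℝ, F))
      (fun τ ↦ TotalSpace.mk' F (c τ) (W τ)) s t ∧
    covAlong (EN := ℝ) F D c W s t = 0

theorem isRightSolution_of_isParallelAlong (e : Trivialization F (π F V))
    [MemTrivializationAtlas e] {c : ℝ → B} {W : Π t : ℝ, V (c t)} {a b : ℝ}
    (hc : ∀ t ∈ Icc a b, MDifferentiableAt 𝓘(ℝ, ℝ) 𝓘(ℝ, EB) c t)
    (he : ∀ t ∈ Icc a b, c t ∈ e.baseSet) (hW : Piecewise (IsParallelAlong D c W) a b) :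
    IsRightSolution (fun t ↦ connectionMatrix e D (c t) (velocity EB c t))
      (fun t ↦ e.continuousLinearMapAt ℝ (c t) (W t)) a b := by
  refine isRightSolution_of_piecewise (hW.mono fun r s har hrs hsb h t ht ↦ ?_)
  have htab : t ∈ Icc a b := ⟨har.trans ht.1, ht.2.trans hsb⟩
  refine (hasDerivWithinAt_coord e D (he t htab) (uniqueDiffOn_Icc hrs t ht) (hc t htab)
    (h t ht).1).congr_deriv ?_
  simp [(h t ht).2]

theorem hasDerivWithinAt_coord_section (e : Trivialization F (π F V))
    [MemTrivializationAtlas e] {c : ℝ → B} {t : ℝ} {σ : Π y, V y} {s : Set ℝ}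
    (hct : c t ∈ e.baseSet) (hs : UniqueDiffWithinAt ℝ s t)
    (hc : MDifferentiableAt 𝓘(ℝ, ℝ) 𝓘(ℝ, EB) c t) (hσ : MDiffAt (T% σ) (c t)) :
    HasDerivWithinAt (fun τ ↦ e.continuousLinearMapAt ℝ (c τ) (σ (c τ)))
      (e.continuousLinearMapAt ℝ (c t) (D σ (c t) (velocity EB c t)) -
        connectionMatrix e D (c t) (velocity EB c t)
          (e.continuousLinearMapAt ℝ (c t) (σ (c t)))) s t := by
  have hs' : UniqueMDiffWithinAt 𝓘(ℝ, ℝ) s t := uniqueMDiffWithinAt_iff_uniqueDiffWithinAt.2 hs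
  refine (hasDerivWithinAt_coord e D hct hs hc
    (hσ.comp_mdifferentiableWithinAt t hc.mdifferentiableWithinAt)).congr_deriv ?_
  rw [covAlong_comp D hs' hc.mdifferentiableWithinAt hσ, mfderivWithin_eq_mfderiv hs' hc]
  rfl

/-- A bilinear map on the fibres that is preserved by the parallel transports along the initial
segments of a curve `c` satisfies the Leibniz rule in the direction of `c`. -/
theorem cov_bilinear_of_transport (hD : D.ContMDiffCovariantDerivative ∞)
    (T : Π y, V y →L[ℝ] V y →L[ℝ] V y) {c : ℝ → B} {δ : ℝ} (hδ : 0 < δ)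
    (hc : ContMDiffOn 𝓘(ℝ, ℝ) 𝓘(ℝ, EB) ∞ c (Ioo (-δ) δ))
    (htrans : ∀ t ∈ Ioo 0 δ, ∃ τ : V (c 0) → V (c t),
      (∀ v, ∃ W : Π r, V (c r), W 0 = v ∧ W t = τ v ∧ Piecewise (IsParallelAlong D c W) 0 t) ∧
      ∀ a b, T (c t) (τ a) (τ b) = τ (T (c 0) a b))
    {σ ρ : Π y, V y} (hσ : MDiffAt (T% σ) (c 0)) (hρ : MDiffAt (T% ρ) (c 0))
    (hT : MDiffAt (T% (fun y ↦ T y (σ y) (ρ y))) (c 0)) :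
    D (fun y ↦ T y (σ y) (ρ y)) (c 0) (velocity EB c 0) =
      T (c 0) (D σ (c 0) (velocity EB c 0)) (ρ (c 0)) +
        T (c 0) (σ (c 0)) (D ρ (c 0) (velocity EB c 0)) := by
  set e := trivializationAt F V (c 0) with he
  have hx : c 0 ∈ e.baseSet := FiberBundle.mem_baseSet_trivializationAt' (c 0)
  have h0 : Ioo (-δ) δ ∈ 𝓝 (0 : ℝ) := Ioo_mem_nhds (by linarith) hδ
  set A : ℝ → F →L[ℝ] F := fun t ↦ connectionMatrix e D (c t) (velocity EB c t) with hA
  have hAcont : ContinuousAt A 0 := continuousAt_connectionMatrix D hD hδ hc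
  -- On `[0, ε]` the curve stays in one trivialization and continuity at `0` bounds `A` by `‖A 0‖ +
  -- 1`.
  obtain ⟨ε, hε, hεδ, hbase, hbound⟩ : ∃ ε, 0 < ε ∧ ε < δ ∧ (∀ t ∈ Icc 0 ε, c t ∈ e.baseSet) ∧
      ∀ t ∈ Icc 0 ε, ‖A t‖ ≤ (‖A 0‖₊ + 1 : NNReal) := by
    have h1 : ∀ᶠ t in 𝓝 (0 : ℝ), c t ∈ e.baseSet :=
      (hc.continuousOn.continuousAt h0).eventually (e.open_baseSet.mem_nhds hx)
    have h2 : ∀ᶠ t in 𝓝 (0 : ℝ), ‖A t‖ < ‖A 0‖ + 1 :=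
      hAcont.norm.eventually (Iio_mem_nhds (by linarith))
    obtain ⟨η, hη, hη'⟩ := Metric.eventually_nhds_iff.1 (h1.and h2)
    have hmin : 0 < min η δ := lt_min hη hδ
    refine ⟨min η δ / 2, by linarith, by linarith [min_le_right η δ], ?_, ?_⟩ <;>
    · intro t ht
      have := hη' (y := t) (by
        rw [Real.dist_eq, sub_zero, abs_of_nonneg ht.1]
        linarith [min_le_left η δ, ht.2])
      first | exact this.1 | exact_mod_cast this.2.le
  have hcd : ∀ t ∈ Icc 0 ε, MDifferentiableAt 𝓘(ℝ, ℝ) 𝓘(ℝ, EB) c t := fun t ht ↦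
    (hc.contMDiffAt (Ioo_mem_nhds (by linarith [ht.1]) (by linarith [ht.2]))).mdifferentiableAt
      (by simp)
  -- Existence of solutions is not taken from a theorem on differential equations: the parallel
  -- sections behind the transport to time `ε` provide them.
  obtain ⟨P, hP0, hP, hPsol⟩ := exists_fundamental_solution (A := A) hε hbound (by
    intro v
    obtain ⟨τ, hτ, -⟩ := htrans ε ⟨hε, hεδ⟩
    obtain ⟨W, hW0, -, hW⟩ := hτ (e.symmL ℝ (c 0) v)
    exact ⟨_, by rw [hW0, e.continuousLinearMapAt_symmL hx],
      isRightSolution_of_isParallelAlong D e hcd hbase hW⟩)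
  let T' : ℝ → F → F → F := fun t a b ↦
    e.continuousLinearMapAt ℝ (c t) (T (c t) (e.symmL ℝ (c t) a) (e.symmL ℝ (c t) b))
  let Φ : F →L[ℝ] F →L[ℝ] F := (LinearMap.mk₂ ℝ (T' 0) (by simp [T']) (by simp [T'])
    (by simp [T']) (by simp [T'])).toContinuousBilinearMap
  have hΦ : ∀ a b, Φ a b = T' 0 a b := fun a b ↦ rfl
  have hinv : ∀ᶠ t in 𝓝[≥] (0 : ℝ), ∀ a b, T' t (P t a) (P t b) = P t (Φ a b) := by
    filter_upwards [Icc_mem_nhdsGE hε] with t ht a b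
    rcases ht.1.eq_or_lt with h | h
    · subst h; simp [hP0, hΦ]
    obtain ⟨τ, hτ, hτT⟩ := htrans t ⟨h, ht.2.trans_lt hεδ⟩
    -- The transports for different `t` are chosen independently; uniqueness forces each of them to
    -- be `P t` in coordinates.
    have hPτ : ∀ v, P t (e.continuousLinearMapAt ℝ (c 0) v) =
        e.continuousLinearMapAt ℝ (c t) (τ v) := by
      intro v
      obtain ⟨W, hW0, hWt, hW⟩ := hτ v
      have := hPsol t ht _ (isRightSolution_of_isParallelAlong D e
        (fun r hr ↦ hcd r ⟨hr.1, hr.2.trans ht.2⟩) (fun r hr ↦ hbase r ⟨hr.1, hr.2.trans ht.2⟩) hW)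
      rw [hW0, hWt] at this
      exact this.symm
    have hct := hbase t ht
    have hPτ' : ∀ a, P t a = e.continuousLinearMapAt ℝ (c t) (τ (e.symmL ℝ (c 0) a)) := fun a ↦ by
      rw [← hPτ, e.continuousLinearMapAt_symmL hx]
    simp only [hΦ, T']
    rw [hPτ, hPτ', hPτ', e.symmL_continuousLinearMapAt hct, e.symmL_continuousLinearMapAt hct, hτT]
  have hu := uniqueDiffWithinAt_Ici (0 : ℝ)
  have hc0 := hcd 0 ⟨le_rfl, hε.le⟩
  have ds := hasDerivWithinAt_coord_section D e hx hu hc0 hσ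
  have dρ := hasDerivWithinAt_coord_section D e hx hu hc0 hρ
  have dT := hasDerivWithinAt_coord_section D e hx hu hc0 hT
  have hTe : (fun t ↦ T' t (e.continuousLinearMapAt ℝ (c t) (σ (c t)))
      (e.continuousLinearMapAt ℝ (c t) (ρ (c t)))) =ᶠ[𝓝[≥] (0 : ℝ)]
      fun t ↦ e.continuousLinearMapAt ℝ (c t) (T (c t) (σ (c t)) (ρ (c t))) := by
    filter_upwards [Icc_mem_nhdsGE hε] with t ht
    simp only [T', e.symmL_continuousLinearMapAt (hbase t ht)]
  have dT' := dT.congr_of_eventuallyEq hTe (hTe.self_of_nhdsWithin self_mem_Ici)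
  have key := leibniz_of_fundamental_solution hP0 hP hinv ds dρ dT'
  -- The coordinates of a section have derivative `coord (D σ) - A (coord σ)`, so each `s' + A s`
  -- collapses to the coordinates of the covariant derivative.
  simp only [hΦ, T', e.symmL_continuousLinearMapAt hx, hA, sub_add_cancel] at key
  have := congrArg (e.symmL ℝ (c 0)) key
  simpa only [map_add, e.symmL_continuousLinearMapAt hx] using this

end TransportedTensor

/-! ### Uniqueness and isometry invariance of the Levi-Civita connection. -/

section LeviCivita

variable {EB : Type*} [NormedAddCommGroup EB] [NormedSpace ℝ EB] [FiniteDimensional ℝ EB]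
  {B : Type*} [TopologicalSpace B] [ChartedSpace EB B] [IsManifold 𝓘(ℝ, EB) ∞ B]
  {metric : ContMDiffRiemannianMetric 𝓘(ℝ, EB) ∞ EB (TangentSpace 𝓘(ℝ, EB) : B → Type _)}

theorem two_le_infty : (2 : ℕ∞ω) ≤ ∞ := ENat.LEInfty.out

/-- A torsion-free metric connection is unique, on differentiable vector fields. -/
theorem cov_eq_of_torsion_free_of_metric
    {nabla nabla' : CovariantDerivative 𝓘(ℝ, EB) EB (TangentSpace 𝓘(ℝ, EB) : B → Type _)}
    (ht : ∀ {X Y : Π p : B, TangentSpace 𝓘(ℝ, EB) p} {p : B}, MDiffAt (T% X) p → MDiffAt (T% Y) p →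
      nabla Y p (X p) - nabla X p (Y p) = nabla' Y p (X p) - nabla' X p (Y p))
    (hm : ∀ (p : B) (σ τ : Π q : B, TangentSpace 𝓘(ℝ, EB) q),
      MDiffAt (T% σ) p → MDiffAt (T% τ) p → ∀ u : TangentSpace 𝓘(ℝ, EB) p,
        metric.inner p (nabla σ p u) (τ p) + metric.inner p (σ p) (nabla τ p u) =
          metric.inner p (nabla' σ p u) (τ p) + metric.inner p (σ p) (nabla' τ p u))
    {σ : Π p : B, TangentSpace 𝓘(ℝ, EB) p} {p : B} (hσ : MDiffAt (T% σ) p) :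
    nabla σ p = nabla' σ p := by
  let S := nabla.difference nabla' p
  have hS : ∀ {τ : Π p : B, TangentSpace 𝓘(ℝ, EB) p}, MDiffAt (T% τ) p → ∀ u,
      S (τ p) u = nabla τ p u - nabla' τ p u := fun {τ} hτ u ↦
    congrArg (fun L : TangentSpace 𝓘(ℝ, EB) p →L[ℝ] TangentSpace 𝓘(ℝ, EB) p ↦ L u)
      (IsCovariantDerivativeOn.difference_apply nabla.isCovariantDerivativeOnUniv
        nabla'.isCovariantDerivativeOnUniv (mem_univ p) hτ)
  have hsec : ∀ v : TangentSpace 𝓘(ℝ, EB) p, ∃ X : Π p : B, TangentSpace 𝓘(ℝ, EB) p,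
      MDiffAt (T% X) p ∧ X p = v := fun v ↦
    ⟨FiberBundle.extend EB v, FiberBundle.mdifferentiableAt_extend 𝓘(ℝ, EB) EB v, by simp⟩
  have hsymm : ∀ u v, S v u = S u v := by
    intro u v
    obtain ⟨X, hX, rfl⟩ := hsec u
    obtain ⟨Y, hY, rfl⟩ := hsec v
    rw [hS hX, hS hY]
    have h := ht hX hY
    rw [sub_eq_sub_iff_sub_eq_sub] at h
    exact h
  have hanti : ∀ u v w, metric.inner p (S v u) w + metric.inner p v (S w u) = 0 := by
    intro u v w
    obtain ⟨X, hX, rfl⟩ := hsec v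
    obtain ⟨Y, hY, rfl⟩ := hsec w
    have := hm p X Y hX hY u
    rw [hS hX, hS hY, map_sub, map_sub, _root_.sub_apply]
    linarith
  have hzero : ∀ u v, S v u = 0 := by
    intro u v
    by_contra h
    refine (metric.pos p _ h).ne' ?_
    -- The form `⟨S v u, w⟩` is symmetric in `v, u` and skew in `v, w`; three cyclic instances of
    -- skewness force it to vanish. Positivity is then applied with `w = S v u`.
    have key : ∀ u v w, metric.inner p (S v u) w = 0 := by
      intro u v w
      have h1 := hanti u v w
      have h2 := hanti v w u
      have h3 := hanti w u v
      rw [metric.symm p v (S w u)] at h1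
      rw [metric.symm p w (S u v), hsymm v w, hsymm v u] at h2
      rw [metric.symm p u (S v w), hsymm w u] at h3
      linarith
    exact key u v _
  ext u
  rw [← sub_eq_zero, ← hS hσ, hzero]

variable {φ ψ : B → B}

/-- Mutually inverse smooth maps have mutually inverse differentials. -/
theorem isInvertible_mfderiv_of_inverse (hφ : CMDiff ∞ φ) (hψ : CMDiff ∞ ψ) (hψφ : ψ ∘ φ = id)
    (hφψ : φ ∘ ψ = id) (p : B) : (mfderiv 𝓘(ℝ, EB) 𝓘(ℝ, EB) φ p).IsInvertible := by
  let Φ : Diffeomorph 𝓘(ℝ, EB) 𝓘(ℝ, EB) B B ∞ :=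
    { toFun := φ, invFun := ψ, left_inv := congrFun hψφ, right_inv := congrFun hφψ
      contMDiff_toFun := hφ, contMDiff_invFun := hψ }
  exact ⟨Φ.mfderivToContinuousLinearEquiv (by simp) p, rfl⟩

theorem mpullback_mpullback_of_inverse (hφ : CMDiff ∞ φ) (hψ : CMDiff ∞ ψ) (hψφ : ψ ∘ φ = id)
    (hφψ : φ ∘ ψ = id) (σ : Π p : B, TangentSpace 𝓘(ℝ, EB) p) :
    mpullback 𝓘(ℝ, EB) 𝓘(ℝ, EB) φ (mpullback 𝓘(ℝ, EB) 𝓘(ℝ, EB) ψ σ) = σ := by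
  ext p
  have h := mpullbackWithin_comp_of_left (I := 𝓘(ℝ, EB)) (I' := 𝓘(ℝ, EB)) (I'' := 𝓘(ℝ, EB))
    (g := ψ) (f := φ) (V := σ) (s := univ) (t := univ) (x₀ := p)
    ((hφ.mdifferentiable (by simp)) p).mdifferentiableWithinAt (mapsTo_univ _ _)
    (uniqueMDiffWithinAt_univ _)
    (by rw [mfderivWithin_univ]; exact isInvertible_mfderiv_of_inverse hψ hφ hφψ hψφ _)
  simp only [mpullbackWithin_univ, hψφ, mpullback_id] at h
  exact h.symm

/-- Push-forward by `φ` is pullback by its inverse, so all transports of fields can be written with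
`mpullback`. -/
theorem mfderiv_eq_mpullback (hφ : CMDiff ∞ φ) (hψ : CMDiff ∞ ψ) (hψφ : ψ ∘ φ = id)
    (hφψ : φ ∘ ψ = id) (σ : Π p : B, TangentSpace 𝓘(ℝ, EB) p) (p : B) :
    mfderiv 𝓘(ℝ, EB) 𝓘(ℝ, EB) φ p (σ p) = mpullback 𝓘(ℝ, EB) 𝓘(ℝ, EB) ψ σ (φ p) := by
  conv_lhs => rw [← mpullback_mpullback_of_inverse hφ hψ hψφ hφψ σ, mpullback_apply]
  exact (isInvertible_mfderiv_of_inverse hφ hψ hψφ hφψ p).self_apply_inverse _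

theorem mdifferentiableAt_mpullback_of_inverse (hφ : CMDiff ∞ φ) (hψ : CMDiff ∞ ψ)
    (hψφ : ψ ∘ φ = id) (hφψ : φ ∘ ψ = id) {σ : Π p : B, TangentSpace 𝓘(ℝ, EB) p} {p : B}
    (hσ : MDiffAt (T% σ) (φ p)) :
    MDiffAt (T% (mpullback 𝓘(ℝ, EB) 𝓘(ℝ, EB) φ σ)) p := by
  have : CompleteSpace EB := FiniteDimensional.complete ℝ EB
  exact hσ.mpullback_vectorField (hφ p) (isInvertible_mfderiv_of_inverse hφ hψ hψφ hφψ p)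
    two_le_infty

/-- The connection transported by a diffeomorphism `φ` with inverse `ψ`. -/
def conjConnection (hφ : CMDiff ∞ φ) (hψ : CMDiff ∞ ψ) (hψφ : ψ ∘ φ = id) (hφψ : φ ∘ ψ = id)
    (nabla : CovariantDerivative 𝓘(ℝ, EB) EB (TangentSpace 𝓘(ℝ, EB) : B → Type _)) :
    CovariantDerivative 𝓘(ℝ, EB) EB (TangentSpace 𝓘(ℝ, EB) : B → Type _) where
  toFun σ p := (mfderiv 𝓘(ℝ, EB) 𝓘(ℝ, EB) φ p).inverse ∘L
    (nabla (mpullback 𝓘(ℝ, EB) 𝓘(ℝ, EB) ψ σ) (φ p)) ∘L mfderiv 𝓘(ℝ, EB) 𝓘(ℝ, EB) φ p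
  isCovariantDerivativeOnUniv :=
    { add := by
        intro σ σ' p hσ hσ' _
        have hp : ψ (φ p) = p := congrFun hψφ p
        rw [mpullback_add, nabla.isCovariantDerivativeOnUniv.add
          (mdifferentiableAt_mpullback_of_inverse hψ hφ hφψ hψφ (by rwa [hp]))
          (mdifferentiableAt_mpullback_of_inverse hψ hφ hφψ hψφ (by rwa [hp]))]
        ext u
        simp
      leibniz := by
        intro σ g p hσ hg _
        have hp : ψ (φ p) = p := congrFun hψφ p
        have hg' : MDiffAt g (ψ (φ p)) := by rwa [hp]
        have hψ' : MDiffAt ψ (φ p) := hψ.mdifferentiable (by simp) _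
        have hφ' : MDiffAt φ p := hφ.mdifferentiable (by simp) _
        rw [mpullback_smul, nabla.isCovariantDerivativeOnUniv.leibniz
          (mdifferentiableAt_mpullback_of_inverse hψ hφ hφψ hψφ (by rwa [hp]))
          (hg'.comp (φ p) hψ')]
        have h1 : (mfderiv 𝓘(ℝ, EB) 𝓘(ℝ, EB) φ p).inverse
            (mpullback 𝓘(ℝ, EB) 𝓘(ℝ, EB) ψ σ (φ p)) = σ p :=
          congrFun (mpullback_mpullback_of_inverse hφ hψ hψφ hφψ σ) p
        have h2 : mvfderiv 𝓘(ℝ, EB) g p =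
            mvfderiv 𝓘(ℝ, EB) (g ∘ ψ) (φ p) ∘L mfderiv 𝓘(ℝ, EB) 𝓘(ℝ, EB) φ p := by
          have := mfderiv_comp p (hg'.comp (φ p) hψ') hφ'
          rwa [Function.comp_assoc, hψφ, Function.comp_id] at this
        ext u
        simp [h1, h2, hp] }

/-- Pullback commutes with the Lie bracket: the identity for the fields pulled back by `ψ` is pulled
back by `φ`. -/
theorem conjConnection_torsion_free (hφ : CMDiff ∞ φ) (hψ : CMDiff ∞ ψ) (hψφ : ψ ∘ φ = id)
    (hφψ : φ ∘ ψ = id)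
    {nabla : CovariantDerivative 𝓘(ℝ, EB) EB (TangentSpace 𝓘(ℝ, EB) : B → Type _)}
    (ht : ∀ {X Y : Π p : B, TangentSpace 𝓘(ℝ, EB) p} {p : B}, MDiffAt (T% X) p → MDiffAt (T% Y) p →
      nabla Y p (X p) - nabla X p (Y p) = mlieBracket 𝓘(ℝ, EB) X Y p)
    {X Y : Π p : B, TangentSpace 𝓘(ℝ, EB) p} {p : B}
    (hX : MDiffAt (T% X) p) (hY : MDiffAt (T% Y) p) :
    conjConnection hφ hψ hψφ hφψ nabla Y p (X p) - conjConnection hφ hψ hψφ hφψ nabla X p (Y p) =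
      mlieBracket 𝓘(ℝ, EB) X Y p := by
  have : CompleteSpace EB := FiniteDimensional.complete ℝ EB
  have : IsManifold 𝓘(ℝ, EB) (minSmoothness ℝ 2) B := by
    rw [minSmoothness_of_isRCLikeNormedField]; infer_instance
  have hp : ψ (φ p) = p := congrFun hψφ p
  have hX' := mdifferentiableAt_mpullback_of_inverse (σ := X) (p := φ p) hψ hφ hφψ hψφ
    (by rwa [hp])
  have hY' := mdifferentiableAt_mpullback_of_inverse (σ := Y) (p := φ p) hψ hφ hφψ hψφ
    (by rwa [hp])
  have hb := mpullback_mlieBracket (I := 𝓘(ℝ, EB)) (n := ∞) (x₀ := p) (f := φ) hX' hY' (hφ p)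
    (by rw [minSmoothness_of_isRCLikeNormedField]; exact two_le_infty)
  rw [mpullback_mpullback_of_inverse hφ hψ hψφ hφψ, mpullback_mpullback_of_inverse hφ hψ hψφ hφψ,
    mpullback_apply, ← ht hX' hY', map_sub, ← mfderiv_eq_mpullback hφ hψ hψφ hφψ,
    ← mfderiv_eq_mpullback hφ hψ hψφ hφψ] at hb
  exact hb

/-- As `φ` is an isometry, `⟨σ, τ⟩` is the function `⟨ψ^*σ, ψ^*τ⟩` composed with `φ`; the chain rule
carries metric compatibility from `φ p` to `p`. -/
theorem conjConnection_metric (hφ : CMDiff ∞ φ) (hψ : CMDiff ∞ ψ) (hψφ : ψ ∘ φ = id)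
    (hφψ : φ ∘ ψ = id)
    (hiso : ∀ (p : B) (v w : TangentSpace 𝓘(ℝ, EB) p),
      metric.inner (φ p) (mfderiv 𝓘(ℝ, EB) 𝓘(ℝ, EB) φ p v) (mfderiv 𝓘(ℝ, EB) 𝓘(ℝ, EB) φ p w) =
        metric.inner p v w)
    {nabla : CovariantDerivative 𝓘(ℝ, EB) EB (TangentSpace 𝓘(ℝ, EB) : B → Type _)}
    (hm : ∀ (p : B) (σ τ : Π q : B, TangentSpace 𝓘(ℝ, EB) q),
      MDiffAt (T% σ) p → MDiffAt (T% τ) p → ∀ u : TangentSpace 𝓘(ℝ, EB) p,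
        mvfderiv 𝓘(ℝ, EB) (fun q ↦ metric.inner q (σ q) (τ q)) p u =
          metric.inner p (nabla σ p u) (τ p) + metric.inner p (σ p) (nabla τ p u))
    (p : B) (σ τ : Π q : B, TangentSpace 𝓘(ℝ, EB) q)
    (hσ : MDiffAt (T% σ) p) (hτ : MDiffAt (T% τ) p) (u : TangentSpace 𝓘(ℝ, EB) p) :
    mvfderiv 𝓘(ℝ, EB) (fun q ↦ metric.inner q (σ q) (τ q)) p u =
      metric.inner p (conjConnection hφ hψ hψφ hφψ nabla σ p u) (τ p) +
        metric.inner p (σ p) (conjConnection hφ hψ hψφ hφψ nabla τ p u) := by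
  have hp : ψ (φ p) = p := congrFun hψφ p
  have hσ' := mdifferentiableAt_mpullback_of_inverse (σ := σ) (p := φ p) hψ hφ hφψ hψφ
    (by rwa [hp])
  have hτ' := mdifferentiableAt_mpullback_of_inverse (σ := τ) (p := φ p) hψ hφ hφψ hψφ
    (by rwa [hp])
  have hinv : ∀ w : TangentSpace 𝓘(ℝ, EB) (φ p), mfderiv 𝓘(ℝ, EB) 𝓘(ℝ, EB) φ p
      ((mfderiv 𝓘(ℝ, EB) 𝓘(ℝ, EB) φ p).inverse w) = w :=
    (isInvertible_mfderiv_of_inverse hφ hψ hψφ hφψ p).self_apply_inverse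
  have hconj : ∀ ρ : Π q : B, TangentSpace 𝓘(ℝ, EB) q, mfderiv 𝓘(ℝ, EB) 𝓘(ℝ, EB) φ p
      (conjConnection hφ hψ hψφ hφψ nabla ρ p u) =
        nabla (mpullback 𝓘(ℝ, EB) 𝓘(ℝ, EB) ψ ρ) (φ p) (mfderiv 𝓘(ℝ, EB) 𝓘(ℝ, EB) φ p u) :=
    fun ρ ↦ hinv _
  rw [← hiso p _ (τ p), ← hiso p (σ p), hconj, hconj, mfderiv_eq_mpullback hφ hψ hψφ hφψ,
    mfderiv_eq_mpullback hφ hψ hψφ hφψ, ← hm _ _ _ hσ' hτ']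
  have hmd : MDiffAt (fun q ↦ metric.inner q (mpullback 𝓘(ℝ, EB) 𝓘(ℝ, EB) ψ σ q)
      (mpullback 𝓘(ℝ, EB) 𝓘(ℝ, EB) ψ τ q)) (φ p) := by
    have h := MDifferentiableAt.clm_bundle_apply₂ (F₁ := EB) (F₂ := EB) (F₃ := ℝ)
      (E₃ := Bundle.Trivial B ℝ) (IB := 𝓘(ℝ, EB)) (IM := 𝓘(ℝ, EB)) (b := fun q : B ↦ q)
      (metric.contMDiff.mdifferentiable (by simp) (φ p)) hσ' hτ'
    exact (mdifferentiableAt_section _ _).1 h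
  have hcomp := mfderiv_comp p hmd (hφ.mdifferentiable (by simp) p)
  refine Eq.trans ?_ (congrArg (fun L : TangentSpace 𝓘(ℝ, EB) p →L[ℝ] ℝ ↦ L u) hcomp)
  have : (fun q ↦ metric.inner q (σ q) (τ q)) = (fun q ↦ metric.inner q
      (mpullback 𝓘(ℝ, EB) 𝓘(ℝ, EB) ψ σ q) (mpullback 𝓘(ℝ, EB) 𝓘(ℝ, EB) ψ τ q)) ∘ φ := by
    ext q
    rw [Function.comp_apply, ← mfderiv_eq_mpullback hφ hψ hψφ hφψ,
      ← mfderiv_eq_mpullback hφ hψ hψφ hφψ, hiso]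
  rw [this]
  rfl

/-- The Levi-Civita connection is invariant under isometries. -/
theorem leviCivita_invariant (hφ : CMDiff ∞ φ) (hψ : CMDiff ∞ ψ) (hψφ : ψ ∘ φ = id)
    (hφψ : φ ∘ ψ = id)
    (hiso : ∀ (p : B) (v w : TangentSpace 𝓘(ℝ, EB) p),
      metric.inner (φ p) (mfderiv 𝓘(ℝ, EB) 𝓘(ℝ, EB) φ p v) (mfderiv 𝓘(ℝ, EB) 𝓘(ℝ, EB) φ p w) =
        metric.inner p v w)
    {nabla : CovariantDerivative 𝓘(ℝ, EB) EB (TangentSpace 𝓘(ℝ, EB) : B → Type _)}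
    (hLC : IsLeviCivita metric nabla) {σ : Π q : B, TangentSpace 𝓘(ℝ, EB) q} {p : B}
    (hσ : MDiffAt (T% σ) (φ p)) (u : TangentSpace 𝓘(ℝ, EB) p) :
    mfderiv 𝓘(ℝ, EB) 𝓘(ℝ, EB) φ p (nabla (mpullback 𝓘(ℝ, EB) 𝓘(ℝ, EB) φ σ) p u) =
      nabla σ (φ p) (mfderiv 𝓘(ℝ, EB) 𝓘(ℝ, EB) φ p u) := by
  have : CompleteSpace EB := FiniteDimensional.complete ℝ EB
  have ht : ∀ {X Y : Π p : B, TangentSpace 𝓘(ℝ, EB) p} {p : B}, MDiffAt (T% X) p →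
      MDiffAt (T% Y) p → nabla Y p (X p) - nabla X p (Y p) = mlieBracket 𝓘(ℝ, EB) X Y p :=
    (nabla.torsion_eq_zero_iff).1 hLC.torsion_eq_zero
  -- Uniqueness is applied to the field `φ^*σ`. In the transported connection `ψ^*φ^*σ = σ`, and the
  -- outer differential of `φ` cancels its inverse.
  have h := cov_eq_of_torsion_free_of_metric (metric := metric) (nabla := nabla)
    (nabla' := conjConnection hφ hψ hψφ hφψ nabla) (p := p)
    (fun hX hY ↦ (ht hX hY).trans (conjConnection_torsion_free hφ hψ hψφ hφψ ht hX hY).symm)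
    (fun p σ τ hσ hτ u ↦ (hLC.metric_compatible p σ τ hσ hτ u).symm.trans
      (conjConnection_metric hφ hψ hψφ hφψ hiso hLC.metric_compatible p σ τ hσ hτ u))
    (mdifferentiableAt_mpullback_of_inverse hφ hψ hψφ hφψ hσ)
  rw [h]
  have hinv := (isInvertible_mfderiv_of_inverse hφ hψ hψφ hφψ p).self_apply_inverse
    (nabla σ (φ p) (mfderiv 𝓘(ℝ, EB) 𝓘(ℝ, EB) φ p u))
  refine Eq.trans ?_ hinv
  change mfderiv 𝓘(ℝ, EB) 𝓘(ℝ, EB) φ p ((mfderiv 𝓘(ℝ, EB) 𝓘(ℝ, EB) φ p).inverse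
    (nabla (mpullback 𝓘(ℝ, EB) 𝓘(ℝ, EB) ψ (mpullback 𝓘(ℝ, EB) 𝓘(ℝ, EB) φ σ)) (φ p) _)) = _
  rw [mpullback_mpullback_of_inverse hψ hφ hφψ hψφ]
  rfl

end LeviCivita

/-! ### Difference tensors of pullback connections. -/

section PullbackSections

variable {EB : Type*} [NormedAddCommGroup EB] [NormedSpace ℝ EB]
  {B : Type*} [TopologicalSpace B] [ChartedSpace EB B]
  {F : Type*} [NormedAddCommGroup F] [NormedSpace ℝ F]
  {V : B → Type*} [TopologicalSpace (TotalSpace F V)]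
  [∀ x, AddCommGroup (V x)] [∀ x, Module ℝ (V x)] [∀ x, TopologicalSpace (V x)]
  [∀ x, IsTopologicalAddGroup (V x)] [∀ x, ContinuousSMul ℝ (V x)]
  [FiberBundle F V] [VectorBundle ℝ F V] [ContMDiffVectorBundle ∞ F V 𝓘(ℝ, EB)]
  {EN : Type*} [NormedAddCommGroup EN] [NormedSpace ℝ EN]
  {N : Type*} [TopologicalSpace N] [ChartedSpace EN N]
  {f : C^∞⟮𝓘(ℝ, EN), N; 𝓘(ℝ, EB), B⟯}

/-- Sections of a pullback bundle are smooth when they are smooth as sections along the map. -/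
theorem contMDiffAt_pullback_section_iff {σ : Π y, ((f : N → B) *ᵖ V) y} {x : N} :
    ContMDiffAt 𝓘(ℝ, EN) (𝓘(ℝ, EN).prod 𝓘(ℝ, F)) ∞
      (fun y ↦ TotalSpace.mk' F (E := (f : N → B) *ᵖ V) y (σ y)) x ↔
    ContMDiffAt 𝓘(ℝ, EN) (𝓘(ℝ, EB).prod 𝓘(ℝ, F)) ∞
      (fun y ↦ TotalSpace.mk' F (E := V) (f y) (σ y)) x := by
  rw [contMDiffAt_section, contMDiffAt_totalSpace]
  exact (and_iff_right f.contMDiff.contMDiffAt).symm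

theorem mdifferentiableAt_pullback_section_iff {σ : Π y, ((f : N → B) *ᵖ V) y} {x : N} :
    MDifferentiableAt 𝓘(ℝ, EN) (𝓘(ℝ, EN).prod 𝓘(ℝ, F))
      (fun y ↦ TotalSpace.mk' F (E := (f : N → B) *ᵖ V) y (σ y)) x ↔
    MDifferentiableAt 𝓘(ℝ, EN) (𝓘(ℝ, EB).prod 𝓘(ℝ, F))
      (fun y ↦ TotalSpace.mk' F (E := V) (f y) (σ y)) x := by
  rw [mdifferentiableAt_section, mdifferentiableAt_totalSpace]
  exact (and_iff_right (f.contMDiff.contMDiffAt.mdifferentiableAt (by simp))).symm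

variable [FiniteDimensional ℝ F] [FiniteDimensional ℝ EN] [FiniteDimensional ℝ EB]
  [IsManifold 𝓘(ℝ, EB) ∞ B] [IsManifold 𝓘(ℝ, EN) ∞ N]

/-- The difference of two pullback connections is the pullback of the difference. -/
theorem difference_pullbackConnection_sub
    (nabla nabla' : CovariantDerivative 𝓘(ℝ, EB) F V)
    (D : CovariantDerivative 𝓘(ℝ, EN) F ((f : N → B) *ᵖ V)) (x : N)
    (a : ((f : N → B) *ᵖ V) x) (u : TangentSpace 𝓘(ℝ, EN) x) :
    (pullbackConnection nabla f).difference D x a u =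
      (pullbackConnection nabla' f).difference D x a u +
        (show ((f : N → B) *ᵖ V) x from
          nabla.difference nabla' (f x) a (mfderiv 𝓘(ℝ, EN) 𝓘(ℝ, EB) f x u)) := by
  have : ContMDiffVectorBundle 1 F ((f : N → B) *ᵖ V) 𝓘(ℝ, EN) := .of_le (n := ∞) (by norm_num)
  obtain ⟨σ, hσ, hx⟩ : ∃ σ : Π y, ((f : N → B) *ᵖ V) y,
      MDifferentiableAt 𝓘(ℝ, EN) (𝓘(ℝ, EN).prod 𝓘(ℝ, F))
        (fun y ↦ TotalSpace.mk' F (E := (f : N → B) *ᵖ V) y (σ y)) x ∧ σ x = a :=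
    ⟨_, FiberBundle.mdifferentiableAt_extend 𝓘(ℝ, EN) F a, by simp⟩
  have h1 := IsCovariantDerivativeOn.difference_apply
    (pullbackConnection nabla f).isCovariantDerivativeOnUniv D.isCovariantDerivativeOnUniv
    (mem_univ x) hσ
  have h2 := IsCovariantDerivativeOn.difference_apply
    (pullbackConnection nabla' f).isCovariantDerivativeOnUniv D.isCovariantDerivativeOnUniv
    (mem_univ x) hσ
  have h3 := IsCovariantDerivativeOn.difference_apply nabla.isCovariantDerivativeOnUniv
    nabla'.isCovariantDerivativeOnUniv (mem_univ (f x)) (mdifferentiableAt_constSection (F := F)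
      (show V (f x) from a))
  have h4 : constSection F (show V (f x) from a) (f x) = a :=
    (trivializationAt F V (f x)).symmL_continuousLinearMapAt
      (FiberBundle.mem_baseSet_trivializationAt' (f x)) _
  rw [hx] at h1 h2
  rw [h4] at h3
  have e1 := congrArg (fun L ↦ L u) h1
  have e2 := congrArg (fun L ↦ L u) h2
  have e3 := congrArg (fun L ↦ L (mfderiv 𝓘(ℝ, EN) 𝓘(ℝ, EB) f x u)) h3
  refine e1.trans ?_
  refine Eq.trans ?_ (congrArg₂ (fun v w : ((f : N → B) *ᵖ V) x ↦ v + w) e2 e3).symm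
  -- The term differentiating the coordinates of `σ` is the same for both connections and drops out;
  -- what remains is their difference on one constant section.
  have e4 : ∀ nabla : CovariantDerivative 𝓘(ℝ, EB) F V,
      (show V (f x) from pullbackConnection nabla f σ x u) =
      (trivializationAt F V (f x)).symmL ℝ (f x) (mvfderiv 𝓘(ℝ, EN)
        (fun y ↦ (trivializationAt F V (f x)).continuousLinearMapAt ℝ (f y)
          (show V (f y) from σ y)) x u) +
        nabla (constSection F (show V (f x) from a)) (f x)
          (mfderiv 𝓘(ℝ, EN) 𝓘(ℝ, EB) f x u) := by
    intro nabla
    change covAlong F nabla f σ univ x u = _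
    simp only [covAlong, mvfderivWithin_univ, mfderivWithin_univ, hx]
    rfl
  have e5 : ∀ p q r s t : V (f x), p = q + r → s = q + t → ∀ d, p - d = s - d + (r - t) := by
    rintro p q r s t rfl rfl d
    abel
  exact e5 _ _ _ _ _ (e4 nabla) (e4 nabla') _

/-- The difference tensor of a pullback connection and another connection, both smooth, takes
differentiable sections to differentiable sections. -/
theorem mdifferentiableAt_difference_pullbackConnection [T2Space B]
    {nabla : CovariantDerivative 𝓘(ℝ, EB) F V} (hnabla : nabla.ContMDiffCovariantDerivative ∞)
    {D : CovariantDerivative 𝓘(ℝ, EN) F ((f : N → B) *ᵖ V)}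
    (hD : D.ContMDiffCovariantDerivative ∞) {σ : Π y, ((f : N → B) *ᵖ V) y}
    {Y : Π y : N, TangentSpace 𝓘(ℝ, EN) y} {x : N}
    (hσ : MDifferentiableAt 𝓘(ℝ, EN) (𝓘(ℝ, EN).prod 𝓘(ℝ, F))
      (fun y ↦ TotalSpace.mk' F (E := (f : N → B) *ᵖ V) y (σ y)) x)  (hY : CMDiff ∞ (T% Y)) :
    MDifferentiableAt 𝓘(ℝ, EN) (𝓘(ℝ, EN).prod 𝓘(ℝ, F))
      (fun y ↦ TotalSpace.mk' F (E := (f : N → B) *ᵖ V) y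
        ((pullbackConnection nabla f).difference D y (σ y) (Y y))) x := by
  have hV1 : ContMDiffVectorBundle 1 F ((f : N → B) *ᵖ V) 𝓘(ℝ, EN) :=
    .of_le (n := ∞) (by norm_num)
  have hV1' : ContMDiffVectorBundle 1 F V 𝓘(ℝ, EB) := .of_le (n := ∞) (by norm_num)
  set e := trivializationAt F V (f x)
  obtain ⟨S, hS, hSe⟩ := exists_smooth_frameSection (F := F) (V := V) (EB := EB) (f x)
  -- The tensor is evaluated on pullbacks of smooth ambient frame sections, where both covariant
  -- derivatives are smooth; `σ` is then expanded in this frame with differentiable coefficients.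
  let R : F → Π y, ((f : N → B) *ᵖ V) y := fun a y ↦ S a (f y)
  have hR : ∀ a y, ContMDiffAt 𝓘(ℝ, EN) (𝓘(ℝ, EN).prod 𝓘(ℝ, F)) ∞
      (fun y ↦ TotalSpace.mk' F (E := (f : N → B) *ᵖ V) y (R a y)) y := fun a y ↦
    contMDiffAt_pullback_section_iff.2 ((hS a).comp f.contMDiff y)
  have hRd : ∀ a y, MDifferentiableAt 𝓘(ℝ, EN) (𝓘(ℝ, EN).prod 𝓘(ℝ, F))
      (fun y ↦ TotalSpace.mk' F (E := (f : N → B) *ᵖ V) y (R a y)) y := fun a y ↦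
    (hR a y).mdifferentiableAt (by simp)
  have hterm : ∀ a, MDifferentiableAt 𝓘(ℝ, EN) (𝓘(ℝ, EN).prod 𝓘(ℝ, F))
      (fun y ↦ TotalSpace.mk' F (E := (f : N → B) *ᵖ V) y
        ((pullbackConnection nabla f).difference D y (R a y) (Y y))) x := by
    intro a
    have h1 : ∀ y, (pullbackConnection nabla f).difference D y (R a y) (Y y) =
        (show ((f : N → B) *ᵖ V) y from
          nabla (S a) (f y) (mfderiv 𝓘(ℝ, EN) 𝓘(ℝ, EB) f y (Y y))) - D (R a) y (Y y) := by
      intro y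
      have e1 := congrArg (fun L ↦ L (Y y)) (IsCovariantDerivativeOn.difference_apply
        (pullbackConnection nabla f).isCovariantDerivativeOnUniv D.isCovariantDerivativeOnUniv
        (mem_univ y) (hRd a y))
      refine e1.trans ?_
      have e2 : pullbackConnection nabla f (R a) y =
          nabla (S a) (f y) ∘L mfderiv 𝓘(ℝ, EN) 𝓘(ℝ, EB) f y := by
        rw [← mfderivWithin_univ]
        exact covAlong_comp nabla (uniqueMDiffWithinAt_univ _)
          (f.contMDiff.contMDiffAt.mdifferentiableAt (by simp)).mdifferentiableWithinAt
          ((hS a).contMDiffAt.mdifferentiableAt (by simp))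
      change pullbackConnection nabla f (R a) y (Y y) - D (R a) y (Y y) = _
      rw [e2]
      rfl
    simp only [h1]
    refine mdifferentiableAt_sub_section ?_ ?_
    · refine mdifferentiableAt_pullback_section_iff.2 ?_
      have hN : ContMDiffAt 𝓘(ℝ, EB) (𝓘(ℝ, EB).prod 𝓘(ℝ, EB →L[ℝ] F)) ∞
          (fun y ↦ TotalSpace.mk' (EB →L[ℝ] F)
            (E := fun y ↦ TangentSpace 𝓘(ℝ, EB) y →L[ℝ] V y) y (nabla (S a) y)) (f x) :=
        (hnabla.contMDiff.contMDiff (σ := S a) (hS a).contMDiffOn).contMDiffAt Filter.univ_mem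
      have hdY : ContMDiffAt 𝓘(ℝ, EN) 𝓘(ℝ, EB).tangent ∞
          (fun y ↦ TotalSpace.mk' EB (E := TangentSpace 𝓘(ℝ, EB)) (f y)
            (mfderiv 𝓘(ℝ, EN) 𝓘(ℝ, EB) f y (Y y))) x :=
        ((f.contMDiff.contMDiff_tangentMap (m := ∞) (by simp)).comp hY : _) x
      exact ((hN.comp x f.contMDiff.contMDiffAt).clm_bundle_apply
        (F₁ := EB) (E₁ := fun y ↦ TangentSpace 𝓘(ℝ, EB) y) (E₂ := V) hdY).mdifferentiableAt
        (by simp)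
    · have hN : ContMDiffAt 𝓘(ℝ, EN) (𝓘(ℝ, EN).prod 𝓘(ℝ, EN →L[ℝ] F)) ∞
          (fun y ↦ TotalSpace.mk' (EN →L[ℝ] F)
            (E := fun y ↦ TangentSpace 𝓘(ℝ, EN) y →L[ℝ] ((f : N → B) *ᵖ V) y) y (D (R a) y)) x :=
        (hD.contMDiff.contMDiff (σ := R a) (fun y _ ↦ (hR a y).contMDiffWithinAt)).contMDiffAt
          Filter.univ_mem
      exact (hN.clm_bundle_apply (F₁ := EN) (E₁ := fun y ↦ TangentSpace 𝓘(ℝ, EN) y)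
        (E₂ := (f : N → B) *ᵖ V) (hY x)).mdifferentiableAt (by simp)
  let b := Module.finBasis ℝ F
  let g : Fin (Module.finrank ℝ F) → N → ℝ := fun i y ↦
    b.coord i (e.continuousLinearMapAt ℝ (f y) (show V (f y) from σ y))
  have hg : ∀ i, MDiffAt (g i) x := fun i ↦
    ((b.coord i).toContinuousLinearMap.mdifferentiableAt.comp x (mdifferentiableAt_coord f hσ) :)
  refine (MDifferentiableAt.sum_section (s := Finset.univ) fun i _ ↦
    (hg i).smul_section (hterm (b i))).congr_of_eventuallyEq ?_
  have hbase : ∀ᶠ y in 𝓝 x, f y ∈ e.baseSet := f.contMDiff.continuous.continuousAt.eventually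
    (e.open_baseSet.mem_nhds (FiberBundle.mem_baseSet_trivializationAt' (f x)))
  filter_upwards [hbase, f.contMDiff.continuous.continuousAt.eventually hSe] with y hy hyS
  have hsum : σ y = ∑ i, g i y • R (b i) y := by
    have h1 : ∀ i, R (b i) y = e.symmL ℝ (f y) (b i) := fun i ↦ hyS (b i)
    have h2 : e.symmL ℝ (f y) (∑ i, g i y • b i) = ∑ i, g i y • e.symmL ℝ (f y) (b i) := by
      simp only [map_sum, map_smul]
    have h3 : ∑ i, g i y • b i = e.continuousLinearMapAt ℝ (f y) (show V (f y) from σ y) :=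
      b.sum_repr _
    rw [h3, e.symmL_continuousLinearMapAt hy] at h2
    simp only [h1]
    exact h2
  rw [hsum]
  simp

end PullbackSections

/-! ### Curves with prescribed velocity. -/

section Curve

variable {EM : Type*} [NormedAddCommGroup EM] [NormedSpace ℝ EM]
  {M : Type*} [TopologicalSpace M] [ChartedSpace EM M] [IsManifold 𝓘(ℝ, EM) ∞ M]

/-- Each tangent vector is the velocity of a smooth curve. -/
theorem exists_curve_velocity (z : TangentBundle 𝓘(ℝ, EM) M) :
    ∃ (c : ℝ → M) (δ : ℝ), 0 < δ ∧ ContMDiffOn 𝓘(ℝ, ℝ) 𝓘(ℝ, EM) ∞ c (Ioo (-δ) δ) ∧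
      z = ⟨c 0, velocity EM c 0⟩ := by
  obtain ⟨x, w⟩ := z
  let u : EM := w
  let ψ := extChartAt 𝓘(ℝ, EM) x
  -- The curve is a straight line in the chart at `x`; the inverse chart has differential the
  -- identity at the image of `x`, so the velocity is `u`.
  let l : ℝ → EM := fun t ↦ ψ x + t • u
  have hl : ContDiff ℝ ∞ l := by fun_prop
  have hl0 : l 0 = ψ x := by simp [l]
  have htgt : ∀ᶠ t in 𝓝 (0 : ℝ), l t ∈ ψ.target := by
    refine hl.continuous.continuousAt.eventually ?_
    rw [hl0]
    exact extChartAt_target_mem_nhds x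
  obtain ⟨δ, hδ, hball⟩ := Metric.eventually_nhds_iff_ball.1 htgt
  have hmaps : MapsTo l (Ioo (-δ) δ) ψ.target := fun t ht ↦ hball t (by
    rw [Metric.mem_ball, Real.dist_eq, sub_zero, abs_lt]; exact ht)
  refine ⟨ψ.symm ∘ l, δ, hδ, (contMDiffOn_extChartAt_symm x).comp
    (contMDiff_iff_contDiff.2 hl).contMDiffOn hmaps, ?_⟩
  have hc0 : (ψ.symm ∘ l) 0 = x := by
    simp only [Function.comp_apply, hl0]; exact extChartAt_to_inv x
  have hψ : HasMFDerivAt 𝓘(ℝ, EM) 𝓘(ℝ, EM) ψ.symm (l 0) (ContinuousLinearMap.id ℝ EM) := by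
    have h1 : MDiffAt ψ.symm (ψ x) :=
      ((contMDiffOn_extChartAt_symm (n := ∞) x).contMDiffAt
        (extChartAt_target_mem_nhds x)).mdifferentiableAt (by simp)
    have h2 := mfderivWithin_range_extChartAt_symm (I := 𝓘(ℝ, EM)) (x := x)
    rw [modelWithCornersSelf_coe, range_id, mfderivWithin_univ] at h2
    have h3 := h1.hasMFDerivAt
    rw [hl0]
    exact h2 ▸ h3
  have hlD : HasMFDerivAt 𝓘(ℝ, ℝ) 𝓘(ℝ, EM) l 0
      (ContinuousLinearMap.toSpanSingleton ℝ u) := by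
    refine HasFDerivAt.hasMFDerivAt ?_
    have : HasDerivAt l u 0 := by
      have h := ((hasDerivAt_id (0 : ℝ)).smul_const u).const_add (ψ x)
      rwa [one_smul] at h
    exact this.hasFDerivAt
  have hv : velocity EM (ψ.symm ∘ l) 0 = u := by
    have h1 := (hψ.comp (0 : ℝ) hlD).mfderiv
    rw [velocity, h1]
    exact one_smul ℝ u
  refine TotalSpace.ext hc0.symm ?_
  exact heq_of_eq hv.symm

end Curve

/-! ### Invariance of the difference of two invariant connections. -/

section Invariance

variable {EB : Type*} [NormedAddCommGroup EB] [NormedSpace ℝ EB] [FiniteDimensional ℝ EB]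
  {B : Type*} [TopologicalSpace B] [T2Space B] [ChartedSpace EB B] [IsManifold 𝓘(ℝ, EB) ∞ B]

/-- The difference of two connections preserved by a map is preserved by the map. -/
theorem difference_invariant {φ : B → B}
    {nabla nabla' : CovariantDerivative 𝓘(ℝ, EB) EB (TangentSpace 𝓘(ℝ, EB) : B → Type _)}
    {p : B} (hinj : (mfderiv 𝓘(ℝ, EB) 𝓘(ℝ, EB) φ p).IsInvertible)
    (hφ : ContMDiffAt 𝓘(ℝ, EB) 𝓘(ℝ, EB) ∞ φ p)
    (h : ∀ σ : Π p : B, TangentSpace 𝓘(ℝ, EB) p, CMDiff ∞ (T% σ) →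
      ∀ u : TangentSpace 𝓘(ℝ, EB) p, mfderiv 𝓘(ℝ, EB) 𝓘(ℝ, EB) φ p
        (nabla (mpullback 𝓘(ℝ, EB) 𝓘(ℝ, EB) φ σ) p u) =
          nabla σ (φ p) (mfderiv 𝓘(ℝ, EB) 𝓘(ℝ, EB) φ p u))
    (h' : ∀ σ : Π p : B, TangentSpace 𝓘(ℝ, EB) p, CMDiff ∞ (T% σ) →
      ∀ u : TangentSpace 𝓘(ℝ, EB) p, mfderiv 𝓘(ℝ, EB) 𝓘(ℝ, EB) φ p
        (nabla' (mpullback 𝓘(ℝ, EB) 𝓘(ℝ, EB) φ σ) p u) =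
          nabla' σ (φ p) (mfderiv 𝓘(ℝ, EB) 𝓘(ℝ, EB) φ p u))
    (v u : TangentSpace 𝓘(ℝ, EB) p) :
    nabla.difference nabla' (φ p) (mfderiv 𝓘(ℝ, EB) 𝓘(ℝ, EB) φ p v)
        (mfderiv 𝓘(ℝ, EB) 𝓘(ℝ, EB) φ p u) =
      mfderiv 𝓘(ℝ, EB) 𝓘(ℝ, EB) φ p (nabla.difference nabla' p v u) := by
  have : CompleteSpace EB := FiniteDimensional.complete ℝ EB
  obtain ⟨S, hS, hSe⟩ := exists_smooth_frameSection (F := EB)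
    (V := (TangentSpace 𝓘(ℝ, EB) : B → Type _)) (EB := EB) (φ p)
  -- `σ` is a global smooth field with value `dφ v` at `φ p`, so `φ^*σ` has value `v` at `p`; the
  -- two difference tensors are computed on this pair.
  set σ := S ((trivializationAt EB (TangentSpace 𝓘(ℝ, EB) : B → Type _)
    (φ p)).continuousLinearMapAt ℝ (φ p) (mfderiv 𝓘(ℝ, EB) 𝓘(ℝ, EB) φ p v)) with hσdef
  have hσ : CMDiff ∞ (T% σ) := hS _
  have hσp : σ (φ p) = mfderiv 𝓘(ℝ, EB) 𝓘(ℝ, EB) φ p v := by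
    rw [hσdef, hSe.self_of_nhds]
    exact (trivializationAt EB (TangentSpace 𝓘(ℝ, EB) : B → Type _)
      (φ p)).symmL_continuousLinearMapAt (FiberBundle.mem_baseSet_trivializationAt' (φ p)) _
  have hσd : MDiffAt (T% σ) (φ p) := (hσ (φ p)).mdifferentiableAt (by simp)
  have hpσ : mpullback 𝓘(ℝ, EB) 𝓘(ℝ, EB) φ σ p = v := by
    rw [mpullback_apply, hσp]
    exact hinj.inverse_apply_self v
  have hpd : MDiffAt (T% (mpullback 𝓘(ℝ, EB) 𝓘(ℝ, EB) φ σ)) p :=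
    hσd.mpullback_vectorField hφ hinj two_le_infty
  have e1 := IsCovariantDerivativeOn.difference_apply nabla.isCovariantDerivativeOnUniv
    nabla'.isCovariantDerivativeOnUniv (mem_univ (φ p)) hσd
  have e2 := IsCovariantDerivativeOn.difference_apply nabla.isCovariantDerivativeOnUniv
    nabla'.isCovariantDerivativeOnUniv (mem_univ p) hpd
  rw [hσp] at e1
  rw [hpσ] at e2
  refine (congrArg (fun L : TangentSpace 𝓘(ℝ, EB) (φ p) →L[ℝ] TangentSpace 𝓘(ℝ, EB) (φ p) ↦
    L (mfderiv 𝓘(ℝ, EB) 𝓘(ℝ, EB) φ p u)) e1).trans ?_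
  refine Eq.trans ?_ (congrArg (fun L : TangentSpace 𝓘(ℝ, EB) p →L[ℝ] TangentSpace 𝓘(ℝ, EB) p ↦
    mfderiv 𝓘(ℝ, EB) 𝓘(ℝ, EB) φ p (L u)) e2).symm
  change nabla σ (φ p) _ - nabla' σ (φ p) _ = mfderiv 𝓘(ℝ, EB) 𝓘(ℝ, EB) φ p (_ - _)
  rw [map_sub, ← h σ hσ u, ← h' σ hσ u]
  rfl

variable {EG : Type*} [NormedAddCommGroup EG] [NormedSpace ℝ EG]
  {G : Type*} [TopologicalSpace G] [ChartedSpace EG G] [Group G]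
  [MulAction G B] [ContMDiffSMul 𝓘(ℝ, EG) 𝓘(ℝ, EB) ∞ G B]
  {metric : ContMDiffRiemannianMetric 𝓘(ℝ, EB) ∞ EB (TangentSpace 𝓘(ℝ, EB) : B → Type _)}

/-- The difference of the Levi-Civita connection and the canonical connection is `G`-invariant. -/
theorem leviCivita_difference_canonical_invariant (hB : IsHomogeneousRiemannian EG G metric)
    {o : B} {𝔪 : Submodule ℝ (GroupLieAlgebra 𝓘(ℝ, EG) G)}
    {nablaCan nablaLC : CovariantDerivative 𝓘(ℝ, EB) EB (TangentSpace 𝓘(ℝ, EB) : B → Type _)}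
    (hCan : IsCanonicalConnection o 𝔪 nablaCan) (hLC : IsLeviCivita metric nablaLC)
    (g : G) (p : B) (v u : TangentSpace 𝓘(ℝ, EB) p) :
    nablaLC.difference nablaCan (g • p) (mfderiv 𝓘(ℝ, EB) 𝓘(ℝ, EB) (fun q : B ↦ g • q) p v)
        (mfderiv 𝓘(ℝ, EB) 𝓘(ℝ, EB) (fun q : B ↦ g • q) p u) =
      mfderiv 𝓘(ℝ, EB) 𝓘(ℝ, EB) (fun q : B ↦ g • q) p (nablaLC.difference nablaCan p v u) := by
  have hsm : ∀ g : G, CMDiff ∞ (fun q : B ↦ g • q) := fun g ↦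
    ContMDiffSMul.contMDiff_const_smul (I := 𝓘(ℝ, EG)) g
  have h1 : (fun q : B ↦ g⁻¹ • q) ∘ (fun q : B ↦ g • q) = id := by ext q; simp
  have h2 : (fun q : B ↦ g • q) ∘ (fun q : B ↦ g⁻¹ • q) = id := by ext q; simp
  exact difference_invariant (φ := fun q : B ↦ g • q)
    (isInvertible_mfderiv_of_inverse (hsm g) (hsm g⁻¹) h1 h2 p) (hsm g p)
    (fun σ hσ u ↦ leviCivita_invariant (hsm g) (hsm g⁻¹) h1 h2 (hB.isometry g) hLC
      ((hσ _).mdifferentiableAt (by simp)) u)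
    (fun σ hσ u ↦ hCan.invariant g σ hσ p u) v u

end Invariance

/-! ### Parallelism on the submanifold and the main equivalence. -/

section Submanifold

variable {EB : Type*} [NormedAddCommGroup EB] [NormedSpace ℝ EB] [FiniteDimensional ℝ EB]
  {B : Type*} [TopologicalSpace B] [T2Space B] [ChartedSpace EB B] [IsManifold 𝓘(ℝ, EB) ∞ B]
  {EM : Type*} [NormedAddCommGroup EM] [NormedSpace ℝ EM] [FiniteDimensional ℝ EM]
  {M : Type*} [TopologicalSpace M] [T2Space M] [ChartedSpace EM M] [IsManifold 𝓘(ℝ, EM) ∞ M]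
  {ι : C^∞⟮𝓘(ℝ, EM), M; 𝓘(ℝ, EB), B⟯}
  {D : CovariantDerivative 𝓘(ℝ, EM) EB (AmbientTangent ι)}
  {G : Type*} [Group G] [MulAction G B]

theorem mfderiv_tangentDeriv (hDTM : IsTangentParallel D) {Y : Π x : M, TangentSpace 𝓘(ℝ, EM) x}
    (hY : CMDiff ∞ (T% Y)) (x : M) (u : TangentSpace 𝓘(ℝ, EM) x) :
    mfderiv 𝓘(ℝ, EM) 𝓘(ℝ, EB) ι x (tangentDeriv D Y x u) = D (tangentSection ι Y) x u :=
  Function.invFun_eq (hDTM Y hY x u)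

theorem mdifferentiableAt_tangentSection {Y : Π x : M, TangentSpace 𝓘(ℝ, EM) x}
    (hY : CMDiff ∞ (T% Y)) (x : M) :
    MDifferentiableAt 𝓘(ℝ, EM) (𝓘(ℝ, EM).prod 𝓘(ℝ, EB))
      (fun y ↦ TotalSpace.mk' EB (E := AmbientTangent ι) y (tangentSection ι Y y)) x := by
  refine mdifferentiableAt_pullback_section_iff.2 ?_
  exact (((ι.contMDiff.contMDiff_tangentMap (m := ∞) (by simp)).comp hY : _) x).mdifferentiableAt
    (by simp)

/-- The parallel transport of a `G`-connection preserves the restriction of a `G`-invariant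
tensor. -/
theorem exists_transport_of_isGConnection (hDG : IsGConnection D G)
    {T : Π p : B, TangentSpace 𝓘(ℝ, EB) p →L[ℝ] TangentSpace 𝓘(ℝ, EB) p →L[ℝ]
      TangentSpace 𝓘(ℝ, EB) p}
    (hT : ∀ (g : G) (p : B) (v u : TangentSpace 𝓘(ℝ, EB) p),
      T (g • p) (mfderiv 𝓘(ℝ, EB) 𝓘(ℝ, EB) (fun q : B ↦ g • q) p v)
        (mfderiv 𝓘(ℝ, EB) 𝓘(ℝ, EB) (fun q : B ↦ g • q) p u) =
      mfderiv 𝓘(ℝ, EB) 𝓘(ℝ, EB) (fun q : B ↦ g • q) p (T p v u))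
    {c : ℝ → M} {a b : ℝ} (hc : IsPiecewiseSmooth EM c a b) :
    ∃ τ : AmbientTangent ι (c a) → AmbientTangent ι (c b),
      (∀ v, ∃ W : Π r, AmbientTangent ι (c r), W a = v ∧ W b = τ v ∧
        Piecewise (IsParallelAlong D c W) a b) ∧
      ∀ v w : AmbientTangent ι (c a), T (ι (c b)) (τ v) (τ w) = τ (T (ι (c a)) v w) := by
  obtain ⟨g, hg⟩ := hDG c a b hc
  choose τ hτ hτg using hg
  refine ⟨τ, fun v ↦ ?_, fun v w ↦ ?_⟩
  · obtain ⟨W, h1, h2, h3⟩ := hτ v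
    exact ⟨W, h1, h2, h3.mono fun _ _ _ _ _ hs ↦ hs.2⟩
  -- With the endpoint generalized to `q`, the base-point part of the total-space equality can be
  -- substituted, after which the fibre parts are comparable.
  · have key : ∀ (q : B) (τ : TangentSpace 𝓘(ℝ, EB) (ι (c a)) → TangentSpace 𝓘(ℝ, EB) q),
        (∀ v, (⟨q, τ v⟩ : TangentBundle 𝓘(ℝ, EB) B) =
          tangentMap 𝓘(ℝ, EB) 𝓘(ℝ, EB) (fun p : B ↦ g • p) ⟨ι (c a), v⟩) →
        ∀ v w, T q (τ v) (τ w) = τ (T (ι (c a)) v w) := by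
      intro q τ hτ
      obtain rfl : q = g • ι (c a) := congrArg TotalSpace.proj (hτ 0)
      have hτ' : ∀ v, τ v =
          mfderiv 𝓘(ℝ, EB) 𝓘(ℝ, EB) (fun q : B ↦ g • q) (ι (c a)) v := fun v ↦ by
        have := hτ v
        rw [tangentMap, TotalSpace.mk.injEq] at this
        exact eq_of_heq this.2
      intro v w
      rw [hτ', hτ', hτ', hT]
    exact key _ τ hτg v w

theorem isPiecewiseSmooth_of_contMDiffOn {c : ℝ → M} {a b : ℝ} (hab : a < b)
    (hc : ContMDiffOn 𝓘(ℝ, ℝ) 𝓘(ℝ, EM) ∞ c (Icc a b)) : IsPiecewiseSmooth EM c a b := by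
  refine ⟨1, ![a, b], ?_, rfl, rfl, fun i ↦ ?_⟩
  · intro i j hij
    fin_cases i <;> fin_cases j <;> simp_all
  · obtain rfl := Subsingleton.elim i 0
    simpa using hc

/-- The restriction of a `G`-invariant tensor is parallel for a `G`-connection. -/
theorem cov_invariant_tensor (hD : D.ContMDiffCovariantDerivative ∞) (hDG : IsGConnection D G)
    {T : Π p : B, TangentSpace 𝓘(ℝ, EB) p →L[ℝ] TangentSpace 𝓘(ℝ, EB) p →L[ℝ]
      TangentSpace 𝓘(ℝ, EB) p}
    (hT : ∀ (g : G) (p : B) (v u : TangentSpace 𝓘(ℝ, EB) p),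
      T (g • p) (mfderiv 𝓘(ℝ, EB) 𝓘(ℝ, EB) (fun q : B ↦ g • q) p v)
        (mfderiv 𝓘(ℝ, EB) 𝓘(ℝ, EB) (fun q : B ↦ g • q) p u) =
      mfderiv 𝓘(ℝ, EB) 𝓘(ℝ, EB) (fun q : B ↦ g • q) p (T p v u))
    {T' : Π x : M, AmbientTangent ι x →L[ℝ] AmbientTangent ι x →L[ℝ] AmbientTangent ι x}
    (hT' : ∀ x a b, T' x a b = T (ι x) a b)
    {σ ρ : Π x : M, AmbientTangent ι x} (x : M) (u : TangentSpace 𝓘(ℝ, EM) x)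
    (hσ : MDifferentiableAt 𝓘(ℝ, EM) (𝓘(ℝ, EM).prod 𝓘(ℝ, EB))
      (fun y ↦ TotalSpace.mk' EB (E := AmbientTangent ι) y (σ y)) x)
    (hρ : MDifferentiableAt 𝓘(ℝ, EM) (𝓘(ℝ, EM).prod 𝓘(ℝ, EB))
      (fun y ↦ TotalSpace.mk' EB (E := AmbientTangent ι) y (ρ y)) x)
    (hTσρ : MDifferentiableAt 𝓘(ℝ, EM) (𝓘(ℝ, EM).prod 𝓘(ℝ, EB))
      (fun y ↦ TotalSpace.mk' EB (E := AmbientTangent ι) y (T' y (σ y) (ρ y))) x) :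
    D (fun y ↦ T' y (σ y) (ρ y)) x u = T' x (D σ x u) (ρ x) + T' x (σ x) (D ρ x u) := by
  obtain ⟨c, δ, hδ, hc, hz⟩ := exists_curve_velocity (⟨x, u⟩ : TangentBundle 𝓘(ℝ, EM) M)
  obtain ⟨rfl, hu⟩ := TotalSpace.mk.inj hz
  obtain rfl := eq_of_heq hu
  -- Each initial segment `[0, t]` has its own group element; invariance of `T` holds for all of
  -- them.
  refine cov_bilinear_of_transport D hD T' hδ hc (fun t ht ↦ ?_) hσ hρ hTσρ
  obtain ⟨τ, h1, h2⟩ := exists_transport_of_isGConnection hDG hT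
    (isPiecewiseSmooth_of_contMDiffOn ht.1 (hc.mono fun r hr ↦
      ⟨by linarith [hr.1], hr.2.trans_lt ht.2⟩))
  refine ⟨τ, h1, fun a b ↦ ?_⟩
  rw [hT', hT']
  exact h2 a b

/-- Two connections of the ambient manifold whose difference is `G`-invariant have the same
behaviour with respect to parallelism of the difference tensor with a `G`-connection. -/
theorem isParallelTensor_diffTensor_iff (hD : D.ContMDiffCovariantDerivative ∞)
    (hDG : IsGConnection D G) (hDTM : IsTangentParallel D)
    {nabla nabla' : CovariantDerivative 𝓘(ℝ, EB) EB (TangentSpace 𝓘(ℝ, EB) : B → Type _)}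
    (hn : nabla.ContMDiffCovariantDerivative ∞) (hn' : nabla'.ContMDiffCovariantDerivative ∞)
    (hT : ∀ (g : G) (p : B) (v u : TangentSpace 𝓘(ℝ, EB) p),
      nabla'.difference nabla (g • p) (mfderiv 𝓘(ℝ, EB) 𝓘(ℝ, EB) (fun q : B ↦ g • q) p v)
        (mfderiv 𝓘(ℝ, EB) 𝓘(ℝ, EB) (fun q : B ↦ g • q) p u) =
      mfderiv 𝓘(ℝ, EB) 𝓘(ℝ, EB) (fun q : B ↦ g • q) p (nabla'.difference nabla p v u)) :
    IsParallelTensor D (diffTensor D nabla) ↔ IsParallelTensor D (diffTensor D nabla') := by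
  let T' : Π x : M, AmbientTangent ι x →L[ℝ] AmbientTangent ι x →L[ℝ] AmbientTangent ι x :=
    fun x ↦ nabla'.difference nabla (ι x)
  have hsub : ∀ (x : M) (a : AmbientTangent ι x) (u : TangentSpace 𝓘(ℝ, EM) x),
      diffTensor D nabla' x a u = diffTensor D nabla x a u +
        T' x a (mfderiv 𝓘(ℝ, EM) 𝓘(ℝ, EB) ι x u) := fun x a u ↦
    difference_pullbackConnection_sub nabla' nabla D x a u
  refine forall₂_congr fun Y hY ↦ forall₂_congr fun σ hσ ↦ forall₂_congr fun x u ↦ ?_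
  have hσd := (hσ x).mdifferentiableAt (by simp)
  have hρd := mdifferentiableAt_tangentSection (ι := ι) hY x
  have hA := mdifferentiableAt_difference_pullbackConnection hn hD hσd hY
  have hA' := mdifferentiableAt_difference_pullbackConnection hn' hD hσd hY
  -- Regularity of `T'` is not proved separately: `T'(σ, Y)` is a difference of two sections already
  -- known to be differentiable.
  have hTd : MDifferentiableAt 𝓘(ℝ, EM) (𝓘(ℝ, EM).prod 𝓘(ℝ, EB))
      (fun y ↦ TotalSpace.mk' EB (E := AmbientTangent ι) y
        (T' y (σ y) (tangentSection ι Y y))) x := by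
    refine (mdifferentiableAt_sub_section hA' hA).congr_of_eventuallyEq (.of_forall fun y ↦ ?_)
    have := hsub y (σ y) (Y y)
    exact congrArg (TotalSpace.mk' EB (E := AmbientTangent ι) y) (eq_sub_of_add_eq' this.symm)
  have hleib := cov_invariant_tensor hD hDG hT (T' := T') (fun _ _ _ ↦ rfl) x u hσd hρd hTd
  have hadd : D (fun y ↦ diffTensor D nabla' y (σ y) (Y y)) x =
      D (fun y ↦ diffTensor D nabla y (σ y) (Y y)) x +
        D (fun y ↦ T' y (σ y) (tangentSection ι Y y)) x := by
    refine Eq.trans ?_ (D.isCovariantDerivativeOnUniv.add hA hTd)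
    exact congrArg (fun τ ↦ D τ x) (funext fun y ↦ hsub y _ _)
  rw [hadd, hsub, hsub, mfderiv_tangentDeriv hDTM hY, _root_.add_apply, hleib]
  -- By the Leibniz rule for `T'`, passing from one connection to the other adds `e + r` to both
  -- sides of the parallelism equation.
  have key : ∀ a b d e r : AmbientTangent ι x, a = b + d ↔ a + (e + r) = b + r + (d + e) := by
    intro a b d e r
    rw [show b + r + (d + e) = b + d + (e + r) by abel, add_left_inj]
  exact key _ _ _ _ _

end Submanifold

end HomStruct

end

theorem lemma4p1
    {EG : Type*} [NormedAddCommGroup EG] [NormedSpace ℝ EG] [FiniteDimensional ℝ EG]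
    {G : Type*} [TopologicalSpace G] [ChartedSpace EG G] [Group G] [LieGroup 𝓘(ℝ, EG) ∞ G]
    {EB : Type*} [NormedAddCommGroup EB] [NormedSpace ℝ EB] [FiniteDimensional ℝ EB]
    {B : Type*} [TopologicalSpace B] [T2Space B] [SecondCountableTopology B]
    [ChartedSpace EB B] [IsManifold 𝓘(ℝ, EB) ∞ B]
    [MulAction G B] [ContMDiffSMul 𝓘(ℝ, EG) 𝓘(ℝ, EB) ∞ G B]
    (metric : ContMDiffRiemannianMetric 𝓘(ℝ, EB) ∞ EB (TangentSpace 𝓘(ℝ, EB) : B → Type _))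
    (hB : HomStruct.IsHomogeneousRiemannian EG G metric)
    (o : B) (𝔪 : Submodule ℝ (GroupLieAlgebra 𝓘(ℝ, EG) G))
    (h𝔪 : HomStruct.IsReductiveDecomposition EB o 𝔪)
    (nablaCan : CovariantDerivative 𝓘(ℝ, EB) EB (TangentSpace 𝓘(ℝ, EB) : B → Type _))
    (hCan : HomStruct.IsCanonicalConnection o 𝔪 nablaCan)
    (nablaLC : CovariantDerivative 𝓘(ℝ, EB) EB (TangentSpace 𝓘(ℝ, EB) : B → Type _))
    (hLC : HomStruct.IsLeviCivita metric nablaLC)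
    {EM : Type*} [NormedAddCommGroup EM] [NormedSpace ℝ EM] [FiniteDimensional ℝ EM]
    {M : Type*} [TopologicalSpace M] [T2Space M] [SecondCountableTopology M]
    [ChartedSpace EM M] [IsManifold 𝓘(ℝ, EM) ∞ M]
    (ι : C^∞⟮𝓘(ℝ, EM), M; 𝓘(ℝ, EB), B⟯)
    (hι : Topology.IsEmbedding ι)
    (hdι : ∀ x : M, Function.Injective (mfderiv 𝓘(ℝ, EM) 𝓘(ℝ, EB) ι x))
    (D : CovariantDerivative 𝓘(ℝ, EM) EB (HomStruct.AmbientTangent ι))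
    (hDsmooth : D.ContMDiffCovariantDerivative ∞)
    (hDG : HomStruct.IsGConnection D G)
    (hDTM : HomStruct.IsTangentParallel D) :
    HomStruct.IsParallelTensor D (HomStruct.diffTensor D nablaCan) ↔
      HomStruct.IsParallelTensor D (HomStruct.diffTensor D nablaLC) := by
  exact HomStruct.isParallelTensor_diffTensor_iff hDsmooth hDG hDTM hCan.smooth hLC.smooth
    (HomStruct.leviCivita_difference_canonical_invariant hB hCan hLC)
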